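/- Let $G$ be a discrete group. An admissible algebra over $G$ is a subspace $L=L(G)$ of $\ell^1(G)$ with its own norm, stronger than the $\ell^1$-norm, such that (a) $L$ is solid: if $l\in L$ and $|k(x)|\le |l(x)|$ for all $x$, then $k\in L$ and $\|k\|_L\le\|l\|_L$; (b) $L$ is a unital Banach $*$-algebra for the convolution and the involution $k^\star(x)=\overline{k(x^{-1})}$ of $\ell^1(G)$. A twisted $C^*$-dynamical system $(A,\alpha,\omega)$ over $G$ consists of a (not necessarily unital) $C^*$-algebra $A$ and maps $\alpha:G\to\mathrm{Aut}(A)$, $\omega:G\times G\to\mathcal{UM}(A)$ (the unitary group of the multiplier algebra) with $$\alpha_x\circ\alpha_y=\mathrm{ad}_{\omega(x,y)}\circ\alpha_{xy},\qquad \omega(x,y)\omega(xy,z)=\alpha_x[\omega(y,z)]\,\omega(x,yz),\qquad \omega(x,e)=1=\omega(e,x).$$ Let $L_{\alpha,\omega}(G;A)$ be the space of all $f:G\to A$ with $\|f(\cdot)\|_A\in L$, with the norm $\big\|\,\|f(\cdot)\|_A\big\|_L$, the product $(f\diamond g)(x)=\sum_{y}f(y)\,\alpha_y[g(y^{-1}x)]\,\omega(y,y^{-1}x)$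 and the involution $f^{\diamond}(x)=\omega(x,x^{-1})^*\alpha_x[f(x^{-1})]^*$; it is a Banach $*$-algebra. A Banach $*$-algebra is symmetric if the spectrum of $b^*b$ is contained in $[0,\infty)$ for every $b$. $G$ is TCP-rigidly $L$-symmetric if $L_{\alpha,\omega}(G;A)$ is symmetric for all $(A,\alpha,\omega)$, and rigidly $L$-symmetric if this holds whenever $\alpha$ and $\omega$ are trivial; the prefix $L$ is dropped if $L=\ell^1(G)$. The enveloping $C^*$-algebra of a Banach $*$-algebra is its Hausdorff completion for the largest $C^*$-seminorm; that of $\ell^1_{\alpha,\omega}(G;A)$ is denoted $A\rtimes_\alpha^\omega G$. A $*$-subalgebra $\mathfrak B$ of an algebra $\mathfrak C$ is inverse closed (spectral) if it contains the inverses of its elements that are invertible in $\mathfrak C$; without assuming units, this is understood to include the same property of $\mathfrak B+\mathbb C1$ in the unitization of $\mathfrak C$. **Theorem.** Let $L$ be an admissible algebra over $G$ and let $G$ be rigidly $L$-symmetric. Then for every twisted $C^*$-dynamical system $(A,\alpha,\omega)$ over $G$: 1. $L_{\alpha,\omega}(G;A)$ is a symmetric Banach $*$-algebra. 2. The canonical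 map of $L_{\alpha,\omega}(G;A)$ to its enveloping $C^*$-algebra is injective, and its image is inverse closed there. 3. For every faithful $*$-representation $\Pi$ of this enveloping $C^*$-algebra on a Hilbert space $H$, the image $\Pi[L_{\alpha,\omega}(G;A)]$ is inverse closed in $\mathbb B(H)$. In particular, if $G$ is rigidly symmetric, then $\ell^1_{\alpha,\omega}(G;A)$ is inverse closed in $A\rtimes_\alpha^\omega G$, and $\Pi[\ell^1_{\alpha,\omega}(G;A)]$ is inverse closed in $\mathbb B(H)$ for every faithful $*$-representation $\Pi$ of $A\rtimes_\alpha^\omega G$ on a Hilbert space $H$. Consequently, for every admissible algebra $L$, the group $G$ is TCP-rigidly $L$-symmetric if and only if it is rigidly $L$-symmetric. -/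

import Mathlib

/-- Complex Banach `*`-algebras, not assumed to have a unit: the norm is complete and
submultiplicative and the involution is isometric. -/
class NonUnitalBanachStarAlgebra (B : Type*) extends NonUnitalNormedRing B, StarRing B,
    CompleteSpace B, NormedSpace ℂ B, IsScalarTower ℂ B B, SMulCommClass ℂ B B, StarModule ℂ B,
    NormedStarGroup B

/-- A Banach `*`-algebra is symmetric if the spectrum of `b⋆ b` is contained in `[0, ∞)` for every
`b`. In a unital algebra the quasispectrum is the spectrum together with `0`; in an algebra without
unit it is the spectrum in the unitization. -/
def IsSymmetricBanachStarAlgebra (B : Type*) [NonUnitalBanachStarAlgebra B] : Prop :=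
  ∀ b : B, ∀ z ∈ quasispectrum ℂ (star b * b), 0 ≤ z.re ∧ z.im = 0

/-- A `C⋆`-seminorm on a Banach `*`-algebra. -/
structure CStarSeminorm (B : Type*) [NonUnitalBanachStarAlgebra B] extends Seminorm ℂ B where
  mul_le' : ∀ a b : B, toFun (a * b) ≤ toFun a * toFun b
  star_mul_self' : ∀ a : B, toFun (star a * a) = toFun a ^ 2

namespace CStarSeminorm

variable {B : Type*} [NonUnitalBanachStarAlgebra B]

/-- The algebra `B` equipped with the topology of the `C⋆`-seminorm `p`. -/
def Pre (_p : CStarSeminorm B) : Type _ := B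

variable (p : CStarSeminorm B)

instance : NonUnitalRing p.Pre := inferInstanceAs (NonUnitalRing B)
instance : StarRing p.Pre := inferInstanceAs (StarRing B)
instance : Module ℂ p.Pre := inferInstanceAs (Module ℂ B)
instance : IsScalarTower ℂ p.Pre p.Pre := inferInstanceAs (IsScalarTower ℂ B B)
instance : SMulCommClass ℂ p.Pre p.Pre := inferInstanceAs (SMulCommClass ℂ B B)
instance : StarModule ℂ p.Pre := inferInstanceAs (StarModule ℂ B)

theorem apply_star_le (b : B) : p.toSeminorm (star b) ≤ p.toSeminorm b := by
  have h : ∀ a : B, p.toSeminorm a ≤ p.toSeminorm (star a) := fun a => by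
    by_cases h0 : p.toSeminorm a = 0
    · rw [h0]; exact apply_nonneg _ _
    · have h1 : 0 < p.toSeminorm a := lt_of_le_of_ne (apply_nonneg _ _) (Ne.symm h0)
      have h2 : p.toSeminorm a ^ 2 ≤ p.toSeminorm (star a) * p.toSeminorm a :=
        (p.star_mul_self' a).symm.trans_le (p.mul_le' (star a) a)
      nlinarith
  simpa using h (star b)

noncomputable instance : NonUnitalSeminormedRing p.Pre where
  toNonUnitalRing := inferInstance
  toPseudoMetricSpace :=
    (p.toSeminorm.toAddGroupSeminorm.toSeminormedAddCommGroup).toPseudoMetricSpace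
  norm := fun b => p.toSeminorm b
  dist_eq := (p.toSeminorm.toAddGroupSeminorm.toSeminormedAddCommGroup).dist_eq
  norm_mul_le := p.mul_le'

theorem norm_pre (b : p.Pre) : ‖b‖ = p.toSeminorm (b : B) := rfl

noncomputable instance : NormedSpace ℂ p.Pre where
  norm_smul_le c b := (map_smul_eq_mul p.toSeminorm c (b : B)).le

instance : NormedStarGroup p.Pre where
  norm_star_le b := p.apply_star_le b

/-- The Hausdorff completion of `B` with respect to the `C⋆`-seminorm `p`; this is the completion
of the quotient of `B` by the kernel of `p`. -/
def CStarCompletion : Type _ := UniformSpace.Completion p.Pre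

namespace CStarCompletion

open UniformSpace UniformSpace.Completion

noncomputable instance : NormedAddCommGroup p.CStarCompletion :=
  inferInstanceAs (NormedAddCommGroup (Completion p.Pre))
instance : CompleteSpace p.CStarCompletion :=
  inferInstanceAs (CompleteSpace (Completion p.Pre))
noncomputable instance : NormedSpace ℂ p.CStarCompletion :=
  inferInstanceAs (NormedSpace ℂ (Completion p.Pre))

/-- The canonical map of `B` to its completion. -/
noncomputable def of (b : p.Pre) : p.CStarCompletion := (b : Completion p.Pre)

theorem isDenseInducing_of : IsDenseInducing (of p) :=
  isDenseInducing_coe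

theorem denseRange_of : DenseRange (of p) := denseRange_coe (α := p.Pre)

theorem continuous_of : Continuous (of p) := continuous_coe p.Pre

theorem norm_of (b : p.Pre) : ‖of p b‖ = p.toSeminorm b := norm_coe (E := p.Pre) b

theorem of_add (a b : p.Pre) : of p (a + b) = of p a + of p b := coe_add (α := p.Pre) a b
theorem continuous_smul' (c : ℂ) : Continuous fun x : p.CStarCompletion => c • x :=
  continuous_const_smul c

theorem of_zero : of p 0 = 0 := rfl
theorem of_smul (c : ℂ) (b : p.Pre) : of p (c • b) = c • of p b := coe_smul (X := p.Pre) c b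

noncomputable instance : Mul p.CStarCompletion :=
  ⟨Function.curry <| ((isDenseInducing_of p).prodMap (isDenseInducing_of p)).extend
    (fun ab : p.Pre × p.Pre => of p (ab.1 * ab.2))⟩

theorem of_mul (a b : p.Pre) : of p (a * b) = of p a * of p b :=
  (((isDenseInducing_of p).prodMap (isDenseInducing_of p)).extend_eq
    ((continuous_of p).comp (continuous_mul (M := p.Pre))) (a, b)).symm

instance : ContinuousMul p.CStarCompletion where
  continuous_mul := by
    let c : p.Pre →+ p.CStarCompletion := ⟨⟨of p, of_zero p⟩, of_add p⟩
    let m := (AddMonoidHom.mul : p.Pre →+ p.Pre →+ p.Pre).compr₂ c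
    have : Continuous fun q : p.Pre × p.Pre => m q.1 q.2 :=
      (continuous_of p).comp (continuous_mul (M := p.Pre))
    have di : IsDenseInducing c := isDenseInducing_of p
    exact (di.extend_Z_bilin di this :)

noncomputable instance : Star p.CStarCompletion :=
  ⟨Completion.map (star : p.Pre → p.Pre)⟩

theorem of_star (b : p.Pre) : of p (star b) = star (of p b) :=
  (Completion.map_coe (star_isometry (E := p.Pre)).uniformContinuous b).symm

instance : ContinuousStar p.CStarCompletion :=
  ⟨Completion.continuous_map⟩

variable {p}

theorem ind {P : p.CStarCompletion → Prop} (a : p.CStarCompletion) (h : IsClosed {a | P a})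
    (h' : ∀ b : p.Pre, P (of p b)) : P a :=
  Completion.induction_on a h h'

theorem ind₂ {P : p.CStarCompletion → p.CStarCompletion → Prop} (a b : p.CStarCompletion)
    (h : IsClosed {q : p.CStarCompletion × p.CStarCompletion | P q.1 q.2})
    (h' : ∀ b c : p.Pre, P (of p b) (of p c)) : P a b :=
  Completion.induction_on₂ a b h h'

theorem ind₃ {P : p.CStarCompletion → p.CStarCompletion → p.CStarCompletion → Prop}
    (a b c : p.CStarCompletion)
    (h : IsClosed {q : p.CStarCompletion × p.CStarCompletion × p.CStarCompletion |
      P q.1 q.2.1 q.2.2})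
    (h' : ∀ b c d : p.Pre, P (of p b) (of p c) (of p d)) : P a b c :=
  Completion.induction_on₃ a b c h h'

variable (p)

noncomputable instance : NonUnitalNormedRing p.CStarCompletion where
  __ := (inferInstance : NormedAddCommGroup p.CStarCompletion)
  left_distrib a b c := by
    induction a, b, c using ind₃ with
    | h => exact isClosed_eq (by fun_prop) (by fun_prop)
    | h' a b c =>
    simp only [← of_add, ← of_mul, mul_add]
  right_distrib a b c := by
    induction a, b, c using ind₃ with
    | h => exact isClosed_eq (by fun_prop) (by fun_prop)
    | h' a b c =>
    simp only [← of_add, ← of_mul, add_mul]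
  zero_mul a := by
    induction a using ind with
    | h => exact isClosed_eq (by fun_prop) (by fun_prop)
    | h' a =>
    rw [← of_zero p, ← of_mul, zero_mul]
  mul_zero a := by
    induction a using ind with
    | h => exact isClosed_eq (by fun_prop) (by fun_prop)
    | h' a =>
    rw [← of_zero p, ← of_mul, mul_zero]
  mul_assoc a b c := by
    induction a, b, c using ind₃ with
    | h => exact isClosed_eq (by fun_prop) (by fun_prop)
    | h' a b c =>
    simp only [← of_mul, mul_assoc]
  norm_mul_le a b := by
    induction a, b using ind₂ with
    | h => exact isClosed_le (by fun_prop) (by fun_prop)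
    | h' a b =>
    simp only [← of_mul, norm_of]
    exact p.mul_le' a b

noncomputable instance : StarRing p.CStarCompletion where
  star_involutive a := by
    induction a using ind with
    | h => exact isClosed_eq (by fun_prop) (by fun_prop)
    | h' a => simp only [← of_star, star_star]
  star_mul a b := by
    induction a, b using ind₂ with
    | h => exact isClosed_eq (by fun_prop) (by fun_prop)
    | h' a b => simp only [← of_star, ← of_mul, star_mul]
  star_add a b := by
    induction a, b using ind₂ with
    | h => exact isClosed_eq (by fun_prop) (by fun_prop)
    | h' a b => simp only [← of_star, ← of_add, star_add]

instance : CStarRing p.CStarCompletion where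
  norm_mul_self_le a := by
    induction a using ind with
    | h => exact isClosed_le (by fun_prop) (by fun_prop)
    | h' a =>
      simp only [← of_star, ← of_mul, norm_of]
      exact ((p.star_mul_self' a).trans (sq _)).ge

instance : IsScalarTower ℂ p.CStarCompletion p.CStarCompletion where
  smul_assoc c a b := by
    simp only [smul_eq_mul]
    induction a, b using ind₂ with
    | h =>
      exact isClosed_eq (((continuous_smul' p c).comp continuous_fst).mul continuous_snd)
        ((continuous_smul' p c).comp (continuous_fst.mul continuous_snd))
    | h' a b => simp only [← of_smul, ← of_mul, smul_mul_assoc]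

instance : SMulCommClass ℂ p.CStarCompletion p.CStarCompletion where
  smul_comm c a b := by
    simp only [smul_eq_mul]
    induction a, b using ind₂ with
    | h =>
      exact isClosed_eq ((continuous_smul' p c).comp (continuous_fst.mul continuous_snd))
        (continuous_fst.mul ((continuous_smul' p c).comp continuous_snd))
    | h' a b => simp only [← of_smul, ← of_mul, mul_smul_comm]

instance : StarModule ℂ p.CStarCompletion where
  star_smul c a := by
    induction a using ind with
    | h =>
      exact isClosed_eq (continuous_star.comp (continuous_smul' p c))
        ((continuous_smul' p (star c)).comp continuous_star)
    | h' a => simp only [← of_smul, ← of_star, star_smul]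

noncomputable instance : NonUnitalCStarAlgebra p.CStarCompletion where

/-- The canonical `*`-homomorphism of `B` to its completion. -/
noncomputable def ofHom : B →⋆ₙₐ[ℂ] p.CStarCompletion where
  toFun := of p
  map_smul' := of_smul p
  map_zero' := of_zero p
  map_add' := of_add p
  map_mul' := of_mul p
  map_star' := of_star p

end CStarCompletion

/-- `C⋆`-seminorms on a Banach `*`-algebra are automatically contractive. -/
theorem apply_le_norm (b : B) : p.toSeminorm b ≤ ‖b‖ := by
  -- an element of norm less than one is quasiregular
  have hq : ∀ a : B, ‖a‖ < 1 → IsQuasiregular a := fun a ha => by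
    rw [isQuasiregular_iff_isUnit' ℂ]
    have h1 : ‖-WithLp.toLp 1 (a : Unitization ℂ B)‖ < 1 := by
      rw [norm_neg]
      simpa [WithLp.unitization_norm_inr] using ha
    have h2 := isUnit_one_sub_of_norm_lt_one h1
    have h3 := h2.map (WithLp.unitizationAlgEquiv ℂ : WithLp 1 (Unitization ℂ B) ≃ₐ[ℂ] _)
    simp at h3
    exact h3
  by_contra! hlt
  let h : B := star b * b
  have hn : ‖h‖ < p.toSeminorm h := by
    calc ‖h‖ ≤ ‖star b‖ * ‖b‖ := norm_mul_le _ _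
      _ = ‖b‖ ^ 2 := by rw [norm_star, sq]
      _ < p.toSeminorm b ^ 2 := by gcongr
      _ = p.toSeminorm h := (p.star_mul_self' b).symm
  let φ := CStarCompletion.ofHom p
  have hsa : IsSelfAdjoint ((φ h : p.CStarCompletion) : Unitization ℂ p.CStarCompletion) :=
    ((IsSelfAdjoint.star_mul_self b).map φ).inr ℂ
  obtain ⟨z, hz, hzn⟩ := spectrum.exists_nnnorm_eq_spectralRadius
    ((φ h : p.CStarCompletion) : Unitization ℂ p.CStarCompletion)
  rw [hsa.spectralRadius_eq_nnnorm, Unitization.nnnorm_inr] at hzn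
  have hzn' : ‖z‖ = p.toSeminorm h := by
    have := congrArg NNReal.toReal (ENNReal.coe_injective hzn)
    simpa using this.trans (CStarCompletion.norm_of p h)
  rw [← Unitization.quasispectrum_eq_spectrum_inr] at hz
  have hz' := NonUnitalAlgHom.quasispectrum_apply_subset (R := ℂ) φ h hz
  have hz0 : z ≠ 0 := by
    rintro rfl
    rw [norm_zero] at hzn'
    exact absurd hn (not_lt.2 (hzn' ▸ norm_nonneg h))
  refine hz' (isUnit_iff_ne_zero.2 hz0) (hq _ ?_)
  have : ‖((isUnit_iff_ne_zero.2 hz0).unit⁻¹ • h)‖ = ‖z‖⁻¹ * ‖h‖ := by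
    rw [Units.smul_def, norm_smul]; simp
  rw [norm_neg, this, hzn', inv_mul_lt_one₀ (lt_of_le_of_lt (norm_nonneg _) hn)]
  exact hn

noncomputable instance : Zero (CStarSeminorm B) :=
  ⟨{ (0 : Seminorm ℂ B) with
      mul_le' := fun _ _ => (zero_mul (0 : ℝ)).ge
      star_mul_self' := fun _ => (zero_pow two_ne_zero).symm }⟩

theorem bddAbove_apply (b : B) : BddAbove (Set.range fun p : CStarSeminorm B => p.toSeminorm b) :=
  ⟨‖b‖, by rintro _ ⟨p, rfl⟩; exact p.apply_le_norm b⟩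

variable (B) in
/-- The largest `C⋆`-seminorm of a Banach `*`-algebra (the Gelfand-Naimark seminorm). -/
noncomputable def greatest : CStarSeminorm B where
  toFun b := ⨆ p : CStarSeminorm B, p.toSeminorm b
  map_zero' := by simp
  add_le' a b := by
    refine ciSup_le fun p => (map_add_le_add p.toSeminorm a b).trans ?_
    exact add_le_add (le_ciSup (bddAbove_apply a) p) (le_ciSup (bddAbove_apply b) p)
  neg' a := by simp
  smul' c a := by
    simp only [map_smul_eq_mul]
    exact (Real.mul_iSup_of_nonneg (norm_nonneg c) _).symm
  mul_le' a b := by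
    refine ciSup_le fun p => (p.mul_le' a b).trans ?_
    exact mul_le_mul (le_ciSup (bddAbove_apply a) p) (le_ciSup (bddAbove_apply b) p)
      (apply_nonneg p.toSeminorm b) (Real.iSup_nonneg fun p => apply_nonneg _ _)
  star_mul_self' a := by
    have hn : ∀ p : CStarSeminorm B, 0 ≤ p.toSeminorm a := fun p => apply_nonneg _ _
    refine le_antisymm (ciSup_le fun p => (p.star_mul_self' a).trans_le ?_) ?_
    · exact pow_le_pow_left₀ (hn p) (le_ciSup (bddAbove_apply a) p) 2
    · have h0 : 0 ≤ ⨆ p : CStarSeminorm B, p.toSeminorm (star a * a) :=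
        Real.iSup_nonneg fun p => apply_nonneg _ _
      rw [← Real.le_sqrt (Real.iSup_nonneg hn) h0]
      refine ciSup_le fun p => Real.le_sqrt_of_sq_le ?_
      exact (p.star_mul_self' a).symm.trans_le (le_ciSup (bddAbove_apply (star a * a)) p)

end CStarSeminorm

/-- The enveloping `C⋆`-algebra of a Banach `*`-algebra: its Hausdorff completion with respect to
the largest `C⋆`-seminorm. -/
abbrev EnvelopingCStarAlgebra (B : Type*) [NonUnitalBanachStarAlgebra B] : Type _ :=
  (CStarSeminorm.greatest B).CStarCompletion

/-- The canonical `*`-homomorphism of a Banach `*`-algebra to its enveloping `C⋆`-algebra. -/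
noncomputable def toEnveloping (B : Type*) [NonUnitalBanachStarAlgebra B] :
    B →⋆ₙₐ[ℂ] EnvelopingCStarAlgebra B :=
  CStarSeminorm.CStarCompletion.ofHom (CStarSeminorm.greatest B)

section AdmissibleAlgebras

/-- Convolution of complex functions on a discrete group. -/
noncomputable def groupConvolution {G : Type*} [Group G] (k l : G → ℂ) : G → ℂ :=
  fun x => ∑' y, k y * l (y⁻¹ * x)

/-- The involution of the convolution algebra of a discrete group. -/
noncomputable def groupInvolution {G : Type*} [Group G] (k : G → ℂ) : G → ℂ :=
  fun x => star (k x⁻¹)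

theorem summable_shear {G : Type*} [Group G] {a b : G → ℝ} (ha : Summable a) (hb : Summable b)
    (ha0 : ∀ x, 0 ≤ a x) (hb0 : ∀ x, 0 ≤ b x) :
    Summable (fun p : G × G => a p.1 * b (p.1⁻¹ * p.2)) ∧
      ∑' p : G × G, a p.1 * b (p.1⁻¹ * p.2) = (∑' x, a x) * ∑' x, b x := by
  let e : G × G ≃ G × G :=
    { toFun := fun p => (p.1, p.1⁻¹ * p.2)
      invFun := fun p => (p.1, p.1 * p.2)
      left_inv := fun p => by simp
      right_inv := fun p => by simp }
  have h := ha.mul_of_nonneg hb ha0 hb0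
  refine ⟨e.summable_iff.2 h, ?_⟩
  rw [ha.tsum_mul_tsum hb h]
  exact e.tsum_eq fun p : G × G => a p.1 * b p.2

theorem summable_groupConvolution {G : Type*} [Group G] {k l : G → ℂ}
    (hk : Summable fun x => ‖k x‖) (hl : Summable fun x => ‖l x‖) :
    (Summable fun x => ‖groupConvolution k l x‖) ∧
      ∑' x, ‖groupConvolution k l x‖ ≤ (∑' x, ‖k x‖) * ∑' x, ‖l x‖ := by
  obtain ⟨h1, h2⟩ := summable_shear hk hl (fun _ => norm_nonneg _) fun _ => norm_nonneg _
  have h3 := h1.prod_symm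
  have h4 : Summable fun x => ∑' y, ‖k y‖ * ‖l (y⁻¹ * x)‖ := h3.prod
  have h5 : ∀ x, ‖groupConvolution k l x‖ ≤ ∑' y, ‖k y‖ * ‖l (y⁻¹ * x)‖ := fun x => by
    have h6 : Summable fun y => ‖k y * l (y⁻¹ * x)‖ := by
      simpa using h3.prod_factor x
    simpa [groupConvolution] using norm_tsum_le_tsum_norm h6
  have h7 := Summable.of_nonneg_of_le (fun _ => norm_nonneg _) h5 h4
  refine ⟨h7, (h7.tsum_le_tsum h5 h4).trans (le_of_eq ?_)⟩
  rw [← h2]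
  exact h3.tsum_prod.symm.trans <| (Equiv.prodComm G G).tsum_eq fun p : G × G => ‖k p.1‖ * ‖l (p.1⁻¹ * p.2)‖

/-- The pointwise norm of an `A`-valued function, as a complex function. -/
noncomputable def absFun {X A : Type*} [NormedAddCommGroup A] (f : X → A) : X → ℂ :=
  fun x => ((‖f x‖ : ℝ) : ℂ)

theorem norm_absFun {X A : Type*} [NormedAddCommGroup A] (f : X → A) (x : X) :
    ‖absFun f x‖ = ‖f x‖ := by
  simp [absFun]

/-- An admissible algebra over a discrete group `G`: a subspace of `ℓ¹(G)` with its own complete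
norm, stronger than the `ℓ¹`-norm, that is a solid space of functions and a unital Banach
`*`-algebra for convolution and the usual involution. Only the values of `nrm` on `carrier`
matter. -/
structure AdmissibleAlgebra (G : Type*) [Group G] where
  carrier : Submodule ℂ (G → ℂ)
  nrm : (G → ℂ) → ℝ
  nrm_add_le : ∀ k ∈ carrier, ∀ l ∈ carrier, nrm (k + l) ≤ nrm k + nrm l
  nrm_smul : ∀ c : ℂ, ∀ k ∈ carrier, nrm (c • k) = ‖c‖ * nrm k
  summable : ∀ k ∈ carrier, Summable fun x => ‖k x‖
  l1_le : ∃ C : ℝ, ∀ k ∈ carrier, ∑' x, ‖k x‖ ≤ C * nrm k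
  complete : ∀ u : ℕ → G → ℂ, (∀ n, u n ∈ carrier) →
    (∀ ε > 0, ∃ N, ∀ m ≥ N, ∀ n ≥ N, nrm (u m - u n) < ε) →
    ∃ k ∈ carrier, Filter.Tendsto (fun n => nrm (u n - k)) Filter.atTop (nhds 0)
  solid : ∀ k l : G → ℂ, l ∈ carrier → (∀ x, ‖k x‖ ≤ ‖l x‖) → k ∈ carrier ∧ nrm k ≤ nrm l
  conv_mem : ∀ k ∈ carrier, ∀ l ∈ carrier, groupConvolution k l ∈ carrier
  nrm_conv_le : ∀ k ∈ carrier, ∀ l ∈ carrier, nrm (groupConvolution k l) ≤ nrm k * nrm l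
  invol_mem : ∀ k ∈ carrier, groupInvolution k ∈ carrier
  nrm_invol : ∀ k ∈ carrier, nrm (groupInvolution k) = nrm k
  one_mem : Set.indicator {1} 1 ∈ carrier

namespace AdmissibleAlgebra

variable {G : Type*} [Group G] (L : AdmissibleAlgebra G)

theorem nrm_zero : L.nrm 0 = 0 := by
  have := L.nrm_smul 0 0 (zero_mem _)
  simpa using this

theorem nrm_nonneg {k : G → ℂ} (hk : k ∈ L.carrier) : 0 ≤ L.nrm k := by
  have h1 := L.nrm_add_le k hk _ (L.carrier.smul_mem (-1) hk)
  rw [L.nrm_smul (-1) k hk] at h1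
  have h2 : k + (-1 : ℂ) • k = 0 := by simp
  rw [h2, nrm_zero] at h1
  simp at h1
  linarith

theorem exists_l1_le : ∃ C : ℝ, 0 ≤ C ∧ ∀ k ∈ L.carrier, ∑' x, ‖k x‖ ≤ C * L.nrm k := by
  obtain ⟨C, hC⟩ := L.l1_le
  refine ⟨max C 0, le_max_right _ _, fun k hk => (hC k hk).trans ?_⟩
  exact mul_le_mul_of_nonneg_right (le_max_left _ _) (L.nrm_nonneg hk)

theorem norm_apply_le_l1 {k : G → ℂ} (hk : k ∈ L.carrier) (x : G) : ‖k x‖ ≤ ∑' y, ‖k y‖ :=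
  (L.summable k hk).le_tsum x fun _ _ => norm_nonneg _

theorem nrm_eq_of_norm_eq {k l : G → ℂ} (hk : k ∈ L.carrier) (h : ∀ x, ‖k x‖ = ‖l x‖) :
    L.nrm l = L.nrm k :=
  le_antisymm (L.solid l k hk fun x => (h x).ge).2
    (L.solid k l (L.solid l k hk fun x => (h x).ge).1 fun x => (h x).le).2

theorem nrm_sub_comm {k l : G → ℂ} (hk : k ∈ L.carrier) (hl : l ∈ L.carrier) :
    L.nrm (k - l) = L.nrm (l - k) :=
  L.nrm_eq_of_norm_eq (L.carrier.sub_mem hl hk) fun x => by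
    simp only [Pi.sub_apply]; exact norm_sub_rev _ _

/-- The space of `A`-valued functions `f` on `G` for which `x ↦ ‖f x‖` belongs to `L`. -/
noncomputable def valued (A : Type*) [NormedAddCommGroup A] [NormedSpace ℂ A] :
    Submodule ℂ (G → A) where
  carrier := {f | absFun f ∈ L.carrier}
  add_mem' {f g} hf hg := by
    refine (L.solid _ _ (L.carrier.add_mem hf hg) fun x => ?_).1
    rw [norm_absFun]
    have : ‖(absFun f + absFun g) x‖ = ‖f x‖ + ‖g x‖ := by
      simp only [absFun, Pi.add_apply, ← Complex.ofReal_add, Complex.norm_real]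
      exact abs_of_nonneg (by positivity)
    rw [this]
    exact norm_add_le _ _
  zero_mem' := by
    refine (L.solid _ 0 (zero_mem _) fun x => ?_).1
    simp [absFun]
  smul_mem' c f hf := by
    refine (L.solid _ _ (L.carrier.smul_mem c hf) fun x => ?_).1
    rw [norm_absFun, Pi.smul_apply, Pi.smul_apply, norm_smul, norm_smul, norm_absFun]

variable (G) in
/-- The algebra `ℓ¹(G)`. -/
noncomputable def l1 : AdmissibleAlgebra G where
  carrier :=
    { carrier := {k | Summable fun x => ‖k x‖}
      add_mem' := fun {k l} hk hl =>
        Summable.of_nonneg_of_le (fun _ => norm_nonneg _) (fun x => norm_add_le (k x) (l x))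
          (Summable.add hk hl)
      zero_mem' := by simp
      smul_mem' := fun c k hk => by
        simpa [norm_smul] using Summable.mul_left ‖c‖ hk }
  nrm k := ∑' x, ‖k x‖
  nrm_add_le k hk l hl := by
    rw [← Summable.tsum_add hk hl]
    refine Summable.tsum_le_tsum (fun x => norm_add_le _ _) ?_ (Summable.add hk hl)
    exact Summable.of_nonneg_of_le (fun _ => norm_nonneg _) (fun x => norm_add_le (k x) (l x))
          (Summable.add hk hl)
  nrm_smul c k hk := by simp [tsum_mul_left]
  summable k hk := hk
  l1_le := ⟨1, fun k _ => (one_mul _).ge⟩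
  complete u hu hc := by
    have hmem : ∀ {k : G → ℂ}, (Summable fun x => ‖k x‖) → Memℓp k 1 := fun hk =>
      memℓp_gen (by simpa using hk)
    have hnorm : ∀ v : lp (fun _ : G => ℂ) 1, ‖v‖ = ∑' x, ‖v x‖ := fun v => by
      rw [lp.norm_eq_tsum_rpow (by simp)]; simp
    let U : ℕ → lp (fun _ : G => ℂ) 1 := fun n => ⟨u n, hmem (hu n)⟩
    have hU : CauchySeq U := Metric.cauchySeq_iff.2 fun ε hε => by
      obtain ⟨N, hN⟩ := hc ε hε
      refine ⟨N, fun m hm n hn => ?_⟩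
      rw [dist_eq_norm, hnorm]
      exact hN m hm n hn
    obtain ⟨v, hv⟩ := cauchySeq_tendsto_of_complete hU
    refine ⟨v, ?_, ?_⟩
    · simpa using (lp.memℓp v).summable (by simp)
    · have := tendsto_iff_norm_sub_tendsto_zero.1 hv
      refine this.congr fun n => ?_
      rw [hnorm]; rfl
  solid k l hl h :=
    have hk : Summable fun x => ‖k x‖ := Summable.of_nonneg_of_le (fun _ => norm_nonneg _) h hl
    ⟨hk, Summable.tsum_le_tsum h hk hl⟩
  conv_mem k hk l hl := (summable_groupConvolution hk hl).1
  nrm_conv_le k hk l hl := (summable_groupConvolution hk hl).2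
  invol_mem k hk := by
    have := (Equiv.inv G).summable_iff.2 hk
    simpa [groupInvolution, Function.comp_def] using this
  nrm_invol k hk := by
    have := (Equiv.inv G).tsum_eq fun x => ‖k x‖
    simpa [groupInvolution] using this
  one_mem := by
    refine summable_of_ne_finset_zero (s := {1}) fun x hx => ?_
    simp at hx
    simp [hx]

end AdmissibleAlgebra

end AdmissibleAlgebras

section TwistedSystems

open scoped MultiplierAlgebra

namespace DoubleCentralizer

variable {A : Type*} [NonUnitalCStarAlgebra A]

/-- A `*`-automorphism of a `C⋆`-algebra as a continuous linear map. -/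
noncomputable def autCLM (σ : A ≃⋆ₐ[ℂ] A) : A →L[ℂ] A where
  toFun := σ
  map_add' := map_add σ
  map_smul' := map_smul σ
  cont := (StarAlgEquiv.isometry σ).continuous

/-- The extension of a `*`-automorphism `σ` of a `C⋆`-algebra to its multiplier algebra, given by
`σ(m) a = σ(m σ⁻¹(a))` and `a σ(m) = σ(σ⁻¹(a) m)`. -/
noncomputable def mapAut (σ : A ≃⋆ₐ[ℂ] A) (m : 𝓜(ℂ, A)) : 𝓜(ℂ, A) where
  fst := (autCLM σ).comp (m.fst.comp (autCLM σ.symm))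
  snd := (autCLM σ).comp (m.snd.comp (autCLM σ.symm))
  central x y := by
    apply EquivLike.injective σ.symm
    simpa [autCLM] using m.central (σ.symm x) (σ.symm y)

theorem mapAut_fst (σ : A ≃⋆ₐ[ℂ] A) (m : 𝓜(ℂ, A)) (a : A) :
    (mapAut σ m).fst (σ a) = σ (m.fst a) := by
  simp [mapAut, autCLM]

theorem mapAut_snd (σ : A ≃⋆ₐ[ℂ] A) (m : 𝓜(ℂ, A)) (a : A) :
    (mapAut σ m).snd (σ a) = σ (m.snd a) := by
  simp [mapAut, autCLM]

theorem coe_injective' : Function.Injective (DoubleCentralizer.coe ℂ : A → 𝓜(ℂ, A)) := by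
  intro a b h
  have h1 : (DoubleCentralizer.coe ℂ a).fst (star (a - b)) =
      (DoubleCentralizer.coe ℂ b).fst (star (a - b)) := by rw [h]
  simp only [coe_fst, ContinuousLinearMap.mul_apply'] at h1
  rw [← sub_eq_zero, ← sub_mul, CStarRing.mul_star_self_eq_zero_iff] at h1
  exact sub_eq_zero.1 h1

theorem coe_mul' (a b : A) :
    DoubleCentralizer.coe ℂ (a * b) = DoubleCentralizer.coe ℂ a * DoubleCentralizer.coe ℂ b :=
  map_mul (coeHom (𝕜 := ℂ) (A := A)) a b

theorem coe_star' (a : A) :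
    DoubleCentralizer.coe ℂ (star a) = star (DoubleCentralizer.coe ℂ a) :=
  map_star (coeHom (𝕜 := ℂ) (A := A)) a

theorem fst_mul' (m : 𝓜(ℂ, A)) (a b : A) : m.fst (a * b) = m.fst a * b := by
  have h : ∀ c : A, c * (m.fst (a * b) - m.fst a * b) = 0 := fun c => by
    rw [mul_sub, ← mul_assoc c, ← m.central, ← m.central, mul_assoc, sub_self]
  have := h (star (m.fst (a * b) - m.fst a * b))
  rw [CStarRing.star_mul_self_eq_zero_iff] at this
  exact sub_eq_zero.1 this

theorem snd_mul' (m : 𝓜(ℂ, A)) (a b : A) : m.snd (a * b) = a * m.snd b := by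
  have h : ∀ c : A, (m.snd (a * b) - a * m.snd b) * c = 0 := fun c => by
    rw [sub_mul, mul_assoc a, m.central, m.central, mul_assoc, sub_self]
  have := h (star (m.snd (a * b) - a * m.snd b))
  rw [CStarRing.mul_star_self_eq_zero_iff] at this
  exact sub_eq_zero.1 this

theorem coe_fst_apply (m : 𝓜(ℂ, A)) (a : A) :
    DoubleCentralizer.coe ℂ (m.fst a) = m * DoubleCentralizer.coe ℂ a := by
  refine ext _ _ _ _ (Prod.ext (ContinuousLinearMap.ext fun b => ?_)
    (ContinuousLinearMap.ext fun b => ?_))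
  · simp [fst_mul']
  · simp [m.central]

theorem coe_snd_apply (m : 𝓜(ℂ, A)) (a : A) :
    DoubleCentralizer.coe ℂ (m.snd a) = DoubleCentralizer.coe ℂ a * m := by
  refine ext _ _ _ _ (Prod.ext (ContinuousLinearMap.ext fun b => ?_)
    (ContinuousLinearMap.ext fun b => ?_))
  · simp [m.central]
  · simp [snd_mul']

theorem norm_unitary_le_one (u : unitary 𝓜(ℂ, A)) : ‖(u : 𝓜(ℂ, A))‖ ≤ 1 := by
  rcases subsingleton_or_nontrivial 𝓜(ℂ, A) with h | h
  · rw [Subsingleton.elim (u : 𝓜(ℂ, A)) 0, norm_zero]; exact zero_le_one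
  · exact (CStarRing.norm_coe_unitary u).le

theorem norm_fst_apply_le (u : unitary 𝓜(ℂ, A)) (a : A) : ‖(u : 𝓜(ℂ, A)).fst a‖ ≤ ‖a‖ := by
  refine ((u : 𝓜(ℂ, A)).fst.le_opNorm a).trans ?_
  rw [norm_fst]
  exact mul_le_of_le_one_left (norm_nonneg _) (norm_unitary_le_one u)

theorem norm_snd_apply_le (u : unitary 𝓜(ℂ, A)) (a : A) : ‖(u : 𝓜(ℂ, A)).snd a‖ ≤ ‖a‖ := by
  refine ((u : 𝓜(ℂ, A)).snd.le_opNorm a).trans ?_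
  rw [norm_snd]
  exact mul_le_of_le_one_left (norm_nonneg _) (norm_unitary_le_one u)

end DoubleCentralizer

/-- A twisted `C⋆`-dynamical system over the discrete group `G` with `C⋆`-algebra `A`: a twisted
action `α` by `*`-automorphisms and a `2`-cocycle `ω` with values in the unitary group of the
multiplier algebra of `A`. -/
structure TwistedSystem (G A : Type*) [Group G] [NonUnitalCStarAlgebra A] where
  α : G → A ≃⋆ₐ[ℂ] A
  ω : G → G → unitary 𝓜(ℂ, A)
  action : ∀ x y a, DoubleCentralizer.coe ℂ (α x (α y a)) =
    (ω x y : 𝓜(ℂ, A)) * DoubleCentralizer.coe ℂ (α (x * y) a) * star (ω x y : 𝓜(ℂ, A))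
  cocycle : ∀ x y z, (ω x y : 𝓜(ℂ, A)) * (ω (x * y) z : 𝓜(ℂ, A)) =
    DoubleCentralizer.mapAut (α x) (ω y z : 𝓜(ℂ, A)) * (ω x (y * z) : 𝓜(ℂ, A))
  ω_one_right : ∀ x, ω x 1 = 1
  ω_one_left : ∀ x, ω 1 x = 1

namespace TwistedSystem

open DoubleCentralizer

variable {G A : Type*} [Group G] [NonUnitalCStarAlgebra A] (S : TwistedSystem G A)

variable (G A) in
/-- The trivial twisted `C⋆`-dynamical system. -/
noncomputable def trivial : TwistedSystem G A where
  α _ := StarAlgEquiv.refl ℂ A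
  ω _ _ := 1
  action x y a := by simp
  cocycle x y z := by
    refine ext _ _ _ _ (Prod.ext (ContinuousLinearMap.ext fun b => ?_)
      (ContinuousLinearMap.ext fun b => ?_))
    · simp [mapAut, autCLM]
    · simp [mapAut, autCLM]
  ω_one_right _ := rfl
  ω_one_left _ := rfl

/-- The element `a α_y(b) ω(y, w)` of `A`. -/
noncomputable def term (y w : G) (a b : A) : A := (S.ω y w : 𝓜(ℂ, A)).snd (a * S.α y b)

/-- The twisted convolution
`(f ⋄ g)(x) = ∑_y f(y) α_y(g(y⁻¹x)) ω(y, y⁻¹x)`. -/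
noncomputable def convolution (f g : G → A) : G → A :=
  fun x => ∑' y, S.term y (y⁻¹ * x) (f y) (g (y⁻¹ * x))

/-- The twisted involution `f^⋄(x) = ω(x, x⁻¹)^* α_x(f(x⁻¹))^*`. -/
noncomputable def involution (f : G → A) : G → A :=
  fun x => (star (S.ω x x⁻¹ : 𝓜(ℂ, A))).fst (star (S.α x (f x⁻¹)))

theorem norm_term_le (y w : G) (a b : A) : ‖S.term y w a b‖ ≤ ‖a‖ * ‖b‖ := by
  refine (norm_snd_apply_le _ _).trans ((norm_mul_le _ _).trans ?_)
  rw [StarAlgEquiv.norm_map]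

/-- `S.term` as a continuous linear map in its first argument. -/
noncomputable def termL (y w : G) (b : A) : A →L[ℂ] A :=
  (S.ω y w : 𝓜(ℂ, A)).snd.comp ((ContinuousLinearMap.mul ℂ A).flip (S.α y b))

/-- `S.term` as a continuous linear map in its second argument. -/
noncomputable def termR (y w : G) (a : A) : A →L[ℂ] A :=
  (S.ω y w : 𝓜(ℂ, A)).snd.comp ((ContinuousLinearMap.mul ℂ A a).comp (autCLM (S.α y)))

theorem termL_apply (y w : G) (a b : A) : S.termL y w b a = S.term y w a b := rfl
theorem termR_apply (y w : G) (a b : A) : S.termR y w a b = S.term y w a b := rfl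

theorem coe_term (y w : G) (a b : A) : DoubleCentralizer.coe ℂ (S.term y w a b) =
    DoubleCentralizer.coe ℂ a * DoubleCentralizer.coe ℂ (S.α y b) * (S.ω y w : 𝓜(ℂ, A)) := by
  rw [term, coe_snd_apply, coe_mul']

theorem coe_map_term (x y w : G) (a b : A) : DoubleCentralizer.coe ℂ (S.α x (S.term y w a b)) =
    DoubleCentralizer.coe ℂ (S.α x a) * DoubleCentralizer.coe ℂ (S.α x (S.α y b)) *
      mapAut (S.α x) (S.ω y w : 𝓜(ℂ, A)) := by
  rw [term, ← mapAut_snd, coe_snd_apply, map_mul, coe_mul']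

theorem star_ω_mul (x y : G) : star (S.ω x y : 𝓜(ℂ, A)) * (S.ω x y : 𝓜(ℂ, A)) = 1 :=
  Unitary.coe_star_mul_self _

theorem ω_mul_star (x y : G) : (S.ω x y : 𝓜(ℂ, A)) * star (S.ω x y : 𝓜(ℂ, A)) = 1 :=
  Unitary.coe_mul_star_self _

theorem term_assoc (y w v : G) (a b c : A) :
    S.term (y * w) v (S.term y w a b) c = S.term y (w * v) a (S.term w v b c) := by
  apply coe_injective'
  rw [coe_term, coe_term, coe_term, coe_map_term, S.action y w c]
  have h := S.cocycle y w v
  have h1 := S.star_ω_mul y w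
  simp only [mul_assoc] at h ⊢
  rw [← h, ← mul_assoc (star _) (S.ω y w : 𝓜(ℂ, A)), h1, one_mul]

theorem coe_star_term (y w : G) (a b : A) : DoubleCentralizer.coe ℂ (star (S.term y w a b)) =
    star (S.ω y w : 𝓜(ℂ, A)) * star (DoubleCentralizer.coe ℂ (S.α y b)) *
      star (DoubleCentralizer.coe ℂ a) := by
  rw [coe_star', coe_term, star_mul, star_mul, mul_assoc]

theorem coe_involution (f : G → A) (x : G) : DoubleCentralizer.coe ℂ (S.involution f x) =
    star (S.ω x x⁻¹ : 𝓜(ℂ, A)) * star (DoubleCentralizer.coe ℂ (S.α x (f x⁻¹))) := by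
  rw [involution, coe_fst_apply, coe_star']

theorem coe_map_involution (y x : G) (f : G → A) :
    DoubleCentralizer.coe ℂ (S.α y (S.involution f x)) =
      mapAut (S.α y) (star (S.ω x x⁻¹ : 𝓜(ℂ, A))) *
        star (DoubleCentralizer.coe ℂ (S.α y (S.α x (f x⁻¹)))) := by
  rw [involution, ← mapAut_fst, coe_fst_apply, map_star, coe_star']

theorem mapAut_star (σ : A ≃⋆ₐ[ℂ] A) (m : 𝓜(ℂ, A)) : mapAut σ (star m) = star (mapAut σ m) := by
  refine ext _ _ _ _ (Prod.ext (ContinuousLinearMap.ext fun b => ?_)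
    (ContinuousLinearMap.ext fun b => ?_))
  · simp [mapAut, autCLM, map_star]
  · simp [mapAut, autCLM, map_star]

theorem involution_involution (f : G → A) : S.involution (S.involution f) = f := by
  funext x
  apply coe_injective'
  rw [coe_involution, coe_map_involution, S.action, mapAut_star]
  have h := S.cocycle x x⁻¹ x
  simp only [mul_inv_cancel, inv_mul_cancel, ω_one_left, ω_one_right, OneMemClass.coe_one,
    mul_one] at h
  have h1 := S.star_ω_mul x x⁻¹
  have h2 : S.α 1 (f x) = f x := by
    apply EquivLike.injective (S.α 1)
    apply coe_injective'
    rw [S.action, ω_one_left]; simp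
  simp only [inv_inv, mul_inv_cancel, h2, ← h]
  simp only [star_mul, star_star, mul_assoc, h1]
  rw [← mul_assoc, h1]; simp

theorem involution_term (x y : G) (f g : G → A) :
    (star (S.ω x x⁻¹ : 𝓜(ℂ, A))).fst (star (S.α x (S.term y (x * y)⁻¹ (f y) (g (x * y)⁻¹)))) =
      S.term (x * y) y⁻¹ (S.involution g (x * y)) (S.involution f y⁻¹) := by
  apply coe_injective'
  rw [coe_fst_apply, coe_star', coe_map_term, coe_term, coe_involution, coe_map_involution,
    mapAut_star, S.action x y, S.action (x * y) y⁻¹]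
  have h1 := S.cocycle x y (x * y)⁻¹
  have h2 := S.cocycle (x * y) y⁻¹ y
  simp only [mul_inv_rev, mul_inv_cancel_left, mul_inv_cancel_right, inv_mul_cancel, inv_inv,
    ω_one_right, OneMemClass.coe_one, mul_one] at h1 h2 ⊢
  have r : ∀ (y w : G) (t : 𝓜(ℂ, A)),
      star (S.ω y w : 𝓜(ℂ, A)) * ((S.ω y w : 𝓜(ℂ, A)) * t) = t := fun y w t => by
    rw [← mul_assoc, S.star_ω_mul, one_mul]
  have h1' := congrArg star h1
  simp only [star_mul] at h1'
  have h1'' : ∀ t : 𝓜(ℂ, A), star (S.ω x x⁻¹ : 𝓜(ℂ, A)) *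
      (star (mapAut (S.α x) (S.ω y (y⁻¹ * x⁻¹) : 𝓜(ℂ, A))) * t) =
        star (S.ω (x * y) (y⁻¹ * x⁻¹) : 𝓜(ℂ, A)) * (star (S.ω x y : 𝓜(ℂ, A)) * t) := fun t => by
    rw [← mul_assoc, ← h1', mul_assoc]
  rw [← h2]
  simp only [star_mul, star_star, mul_assoc, r, h1'', S.star_ω_mul, mul_one]

theorem norm_involution_le (f : G → A) (x : G) : ‖S.involution f x‖ ≤ ‖f x⁻¹‖ := by
  refine (norm_fst_apply_le (star (S.ω x x⁻¹)) _).trans ?_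
  rw [norm_star, StarAlgEquiv.norm_map]

theorem involution_add (f g : G → A) :
    S.involution (f + g) = S.involution f + S.involution g := by
  funext x
  simp [involution]

theorem involution_smul (c : ℂ) (f : G → A) :
    S.involution (c • f) = star c • S.involution f := by
  funext x
  simp [involution]

section Summable

variable {f g h : G → A}

theorem summable_norm_term (hf : Summable fun x => ‖f x‖) (hg : Summable fun x => ‖g x‖) (x : G) :
    Summable fun y => ‖f y‖ * ‖g (y⁻¹ * x)‖ :=
  ((summable_shear hf hg (fun _ => norm_nonneg _) fun _ => norm_nonneg _).1.prod_symm).prod_factor x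

theorem summable_term (hf : Summable fun x => ‖f x‖) (hg : Summable fun x => ‖g x‖) (x : G) :
    Summable fun y => S.term y (y⁻¹ * x) (f y) (g (y⁻¹ * x)) :=
  Summable.of_norm_bounded (summable_norm_term hf hg x) fun _ => S.norm_term_le _ _ _ _

theorem norm_convolution_le (hf : Summable fun x => ‖f x‖) (hg : Summable fun x => ‖g x‖) (x : G) :
    ‖S.convolution f g x‖ ≤ ‖groupConvolution (absFun f) (absFun g) x‖ := by
  have h1 : groupConvolution (absFun f) (absFun g) x =
      ((∑' y, ‖f y‖ * ‖g (y⁻¹ * x)‖ : ℝ) : ℂ) := by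
    simp [groupConvolution, absFun, Complex.ofReal_tsum]
  rw [h1, Complex.norm_real]
  refine le_trans ?_ (le_abs_self _)
  exact tsum_of_norm_bounded (summable_norm_term hf hg x).hasSum fun _ => S.norm_term_le _ _ _ _

theorem convolution_add (hf : Summable fun x => ‖f x‖) (hg : Summable fun x => ‖g x‖)
    (hh : Summable fun x => ‖h x‖) :
    S.convolution f (g + h) = S.convolution f g + S.convolution f h := by
  funext x
  simp only [convolution, Pi.add_apply]
  rw [← (S.summable_term hf hg x).tsum_add (S.summable_term hf hh x)]
  exact tsum_congr fun y => map_add (S.termR y (y⁻¹ * x) (f y)) _ _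

theorem add_convolution (hf : Summable fun x => ‖f x‖) (hg : Summable fun x => ‖g x‖)
    (hh : Summable fun x => ‖h x‖) :
    S.convolution (f + g) h = S.convolution f h + S.convolution g h := by
  funext x
  simp only [convolution, Pi.add_apply]
  rw [← (S.summable_term hf hh x).tsum_add (S.summable_term hg hh x)]
  exact tsum_congr fun y => map_add (S.termL y (y⁻¹ * x) (h (y⁻¹ * x))) _ _

theorem smul_convolution (c : ℂ) (f g : G → A) :
    S.convolution (c • f) g = c • S.convolution f g := by
  funext x
  simp only [convolution, Pi.smul_apply]
  rw [← tsum_const_smul'' c]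
  exact tsum_congr fun y => map_smul (S.termL y (y⁻¹ * x) (g (y⁻¹ * x))) _ _

theorem convolution_smul (c : ℂ) (f g : G → A) :
    S.convolution f (c • g) = c • S.convolution f g := by
  funext x
  simp only [convolution, Pi.smul_apply]
  rw [← tsum_const_smul'' c]
  exact tsum_congr fun y => map_smul (S.termR y (y⁻¹ * x) (f y)) _ _

theorem convolution_assoc (hf : Summable fun x => ‖f x‖) (hg : Summable fun x => ‖g x‖)
    (hh : Summable fun x => ‖h x‖) :
    S.convolution (S.convolution f g) h = S.convolution f (S.convolution g h) := by
  funext x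
  have hb : ∀ z, ‖h z‖ ≤ ∑' x, ‖h x‖ := fun z => hh.le_tsum z fun _ _ => norm_nonneg _
  let T : G → G → A := fun z y =>
    S.term z (z⁻¹ * x) (S.term y (y⁻¹ * z) (f y) (g (y⁻¹ * z))) (h (z⁻¹ * x))
  have hT : Summable (Function.uncurry T) := by
    have h1 := (summable_shear hf hg (fun _ => norm_nonneg _) fun _ => norm_nonneg _).1.prod_symm
    refine Summable.of_norm_bounded (h1.mul_right (∑' x, ‖h x‖)) fun p => ?_
    refine (S.norm_term_le _ _ _ _).trans ?_
    exact mul_le_mul (S.norm_term_le _ _ _ _) (hb _) (norm_nonneg _) (by positivity)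
  have e1 : S.convolution (S.convolution f g) h x = ∑' z, ∑' y, T z y := by
    refine tsum_congr fun z => ?_
    exact (S.termL z (z⁻¹ * x) (h (z⁻¹ * x))).map_tsum (S.summable_term hf hg z)
  have e2 : S.convolution f (S.convolution g h) x = ∑' y, ∑' z, T z y := by
    refine tsum_congr fun y => ?_
    have e3 := (S.termR y (y⁻¹ * x) (f y)).map_tsum (S.summable_term hg hh (y⁻¹ * x))
    refine e3.trans ?_
    rw [← (Equiv.mulLeft y).tsum_eq fun z => T z y]
    refine tsum_congr fun w => ?_
    have e4 := S.term_assoc y w (w⁻¹ * (y⁻¹ * x)) (f y) (g w) (h (w⁻¹ * (y⁻¹ * x)))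
    simp only [mul_inv_cancel_left] at e4
    simp only [T, Equiv.coe_mulLeft, termR_apply, mul_inv_rev, inv_mul_cancel_left, mul_assoc]
    exact e4.symm
  rw [e1, e2]
  exact hT.tsum_comm.symm

theorem involution_convolution (hf : Summable fun x => ‖f x‖) (hg : Summable fun x => ‖g x‖) :
    S.involution (S.convolution f g) = S.convolution (S.involution g) (S.involution f) := by
  funext x
  have hs := S.summable_term hf hg x⁻¹
  have e1 := (autCLM (S.α x)).map_tsum hs
  have hs1 := (autCLM (S.α x)).summable hs
  have e2 : star (S.α x (S.convolution f g x⁻¹)) =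
      ∑' y, star (S.α x (S.term y (y⁻¹ * x⁻¹) (f y) (g (y⁻¹ * x⁻¹)))) := by
    rw [← tsum_star]
    exact congrArg star e1
  have e3 := ((star (S.ω x x⁻¹ : 𝓜(ℂ, A))).fst).map_tsum hs1.star
  rw [involution, e2]
  refine e3.trans ?_
  rw [convolution, ← (Equiv.mulLeft x).tsum_eq fun z =>
    S.term z (z⁻¹ * x) (S.involution g z) (S.involution f (z⁻¹ * x))]
  refine tsum_congr fun y => ?_
  have e4 := S.involution_term x y f g
  simp only [mul_inv_rev] at e4
  simp only [Equiv.coe_mulLeft, mul_inv_rev, mul_assoc, inv_mul_cancel, mul_one]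
  exact e4

end Summable

end TwistedSystem

end TwistedSystems

section CrossedProducts

/-- The twisted crossed product of `L`-type: the functions `f : G → A` for which `x ↦ ‖f x‖`
belongs to `L`, with the norm of `x ↦ ‖f x‖` in `L`, the twisted convolution and the twisted
involution. -/
def TwistedCrossedProduct {G A : Type*} [Group G] [NonUnitalCStarAlgebra A]
    (L : AdmissibleAlgebra G) (_S : TwistedSystem G A) : Type _ := L.valued A

namespace TwistedCrossedProduct

variable {G A : Type*} [Group G] [NonUnitalCStarAlgebra A] (L : AdmissibleAlgebra G)
  (S : TwistedSystem G A)

noncomputable instance : AddCommGroup (TwistedCrossedProduct L S) :=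
  inferInstanceAs (AddCommGroup (L.valued A))
noncomputable instance : Module ℂ (TwistedCrossedProduct L S) :=
  inferInstanceAs (Module ℂ (L.valued A))

variable {L S}

/-- The function on the group underlying an element of the twisted crossed product. -/
def fn (f : TwistedCrossedProduct L S) : G → A := (show L.valued A from f).1

theorem ext {f g : TwistedCrossedProduct L S} (h : f.fn = g.fn) : f = g :=
  Subtype.ext (p := fun f => f ∈ L.valued A) h

theorem absFun_mem (f : TwistedCrossedProduct L S) : absFun f.fn ∈ L.carrier :=
  (show L.valued A from f).2

theorem summable (f : TwistedCrossedProduct L S) : Summable fun x => ‖f.fn x‖ := by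
  simpa [norm_absFun] using L.summable _ f.absFun_mem

/-- An element of the twisted crossed product, from a function on the group. -/
def mk (f : G → A) (hf : absFun f ∈ L.carrier) : TwistedCrossedProduct L S :=
  (⟨f, hf⟩ : L.valued A)

theorem fn_mk (f : G → A) (hf : absFun f ∈ L.carrier) :
    (mk f hf : TwistedCrossedProduct L S).fn = f := rfl
theorem fn_add (f g : TwistedCrossedProduct L S) : (f + g).fn = f.fn + g.fn := rfl
theorem fn_sub (f g : TwistedCrossedProduct L S) : (f - g).fn = f.fn - g.fn := rfl
theorem fn_zero : (0 : TwistedCrossedProduct L S).fn = 0 := rfl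
theorem fn_smul (c : ℂ) (f : TwistedCrossedProduct L S) : (c • f).fn = c • f.fn := rfl

theorem convolution_mem (f g : TwistedCrossedProduct L S) :
    absFun (S.convolution f.fn g.fn) ∈ L.carrier ∧
      L.nrm (absFun (S.convolution f.fn g.fn)) ≤ L.nrm (absFun f.fn) * L.nrm (absFun g.fn) := by
  obtain ⟨h1, h2⟩ := L.solid (absFun (S.convolution f.fn g.fn)) _
    (L.conv_mem _ f.absFun_mem _ g.absFun_mem) fun x => by
      rw [norm_absFun]; exact S.norm_convolution_le f.summable g.summable x
  exact ⟨h1, h2.trans (L.nrm_conv_le _ f.absFun_mem _ g.absFun_mem)⟩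

theorem involution_mem (f : TwistedCrossedProduct L S) :
    absFun (S.involution f.fn) ∈ L.carrier ∧
      L.nrm (absFun (S.involution f.fn)) ≤ L.nrm (absFun f.fn) := by
  obtain ⟨h1, h2⟩ := L.solid (absFun (S.involution f.fn)) _
    (L.invol_mem _ f.absFun_mem) fun x => by
      rw [norm_absFun, groupInvolution, norm_star, norm_absFun]; exact S.norm_involution_le f.fn x
  exact ⟨h1, h2.trans (L.nrm_invol _ f.absFun_mem).le⟩

noncomputable instance : Norm (TwistedCrossedProduct L S) := ⟨fun f => L.nrm (absFun f.fn)⟩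

theorem norm_def (f : TwistedCrossedProduct L S) : ‖f‖ = L.nrm (absFun f.fn) := rfl

theorem norm_le_of_bound (f : TwistedCrossedProduct L S) (k : G → ℂ) (hk : k ∈ L.carrier)
    (h : ∀ x, ‖f.fn x‖ ≤ ‖k x‖) : ‖f‖ ≤ L.nrm k :=
  (L.solid _ k hk fun x => by rw [norm_absFun]; exact h x).2

noncomputable instance : NormedAddCommGroup (TwistedCrossedProduct L S) :=
  AddGroupNorm.toNormedAddCommGroup
    { toFun := fun f => ‖f‖
      map_zero' := by
        rw [norm_def]
        have : absFun (0 : TwistedCrossedProduct L S).fn = 0 := by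
          funext x; simp [absFun, fn_zero]
        rw [this, L.nrm_zero]
      add_le' := fun f g => by
        refine (norm_le_of_bound _ (absFun f.fn + absFun g.fn)
          (L.carrier.add_mem f.absFun_mem g.absFun_mem) fun x => ?_).trans
            (L.nrm_add_le _ f.absFun_mem _ g.absFun_mem)
        have : ‖(absFun f.fn + absFun g.fn) x‖ = ‖f.fn x‖ + ‖g.fn x‖ := by
          simp only [absFun, Pi.add_apply, ← Complex.ofReal_add, Complex.norm_real]
          exact abs_of_nonneg (by positivity)
        rw [this]
        exact norm_add_le _ _
      neg' := fun f => by
        refine L.nrm_eq_of_norm_eq f.absFun_mem fun x => ?_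
        rw [norm_absFun, norm_absFun]
        exact (norm_neg (f.fn x)).symm
      eq_zero_of_map_eq_zero' := fun f hf => by
        obtain ⟨C, -, hC⟩ := L.exists_l1_le
        refine ext (funext fun x => ?_)
        have h1 := (L.norm_apply_le_l1 f.absFun_mem x).trans (hC _ f.absFun_mem)
        have h2 : L.nrm (absFun f.fn) = 0 := hf
        rw [h2, mul_zero, norm_absFun] at h1
        exact norm_le_zero_iff.1 h1 }

noncomputable instance : NormedSpace ℂ (TwistedCrossedProduct L S) where
  norm_smul_le c f := by
    rw [norm_def, norm_def, ← L.nrm_smul c _ f.absFun_mem]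
    refine (L.solid _ _ (L.carrier.smul_mem c f.absFun_mem) fun x => ?_).2
    rw [norm_absFun, fn_smul, Pi.smul_apply, Pi.smul_apply, norm_smul, norm_smul, norm_absFun]

noncomputable instance : Mul (TwistedCrossedProduct L S) :=
  ⟨fun f g => mk (S.convolution f.fn g.fn) (convolution_mem f g).1⟩

theorem fn_mul (f g : TwistedCrossedProduct L S) : (f * g).fn = S.convolution f.fn g.fn := rfl

noncomputable instance : Star (TwistedCrossedProduct L S) :=
  ⟨fun f => mk (S.involution f.fn) (involution_mem f).1⟩

theorem fn_star (f : TwistedCrossedProduct L S) : (star f).fn = S.involution f.fn := rfl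

noncomputable instance : NonUnitalNormedRing (TwistedCrossedProduct L S) where
  __ := (inferInstance : NormedAddCommGroup (TwistedCrossedProduct L S))
  left_distrib f g h := ext (S.convolution_add f.summable g.summable h.summable)
  right_distrib f g h := ext (S.add_convolution f.summable g.summable h.summable)
  zero_mul f := ext (by
    have := S.smul_convolution 0 (0 : G → A) f.fn
    simpa [fn_mul, fn_zero] using this)
  mul_zero f := ext (by
    have := S.convolution_smul 0 f.fn (0 : G → A)
    simpa [fn_mul, fn_zero] using this)
  mul_assoc f g h := ext (S.convolution_assoc f.summable g.summable h.summable)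
  norm_mul_le f g := (convolution_mem f g).2

instance : IsScalarTower ℂ (TwistedCrossedProduct L S) (TwistedCrossedProduct L S) where
  smul_assoc c f g := ext (S.smul_convolution c f.fn g.fn)

instance : SMulCommClass ℂ (TwistedCrossedProduct L S) (TwistedCrossedProduct L S) where
  smul_comm c f g := ext (S.convolution_smul c f.fn g.fn).symm

noncomputable instance : StarRing (TwistedCrossedProduct L S) where
  star_involutive f := ext (S.involution_involution f.fn)
  star_mul f g := ext (S.involution_convolution f.summable g.summable)
  star_add f g := ext (S.involution_add f.fn g.fn)

instance : StarModule ℂ (TwistedCrossedProduct L S) where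
  star_smul c f := ext (S.involution_smul c f.fn)

instance : NormedStarGroup (TwistedCrossedProduct L S) where
  norm_star_le f := (involution_mem f).2

theorem fn_sum {ι : Type*} (s : Finset ι) (u : ι → TwistedCrossedProduct L S) (x : G) :
    (∑ i ∈ s, u i).fn x = ∑ i ∈ s, (u i).fn x := by
  classical
  induction s using Finset.induction_on with
  | empty => simp [fn_zero]
  | insert a s ha ih => rw [Finset.sum_insert ha, Finset.sum_insert ha, fn_add, Pi.add_apply, ih]

instance : CompleteSpace (TwistedCrossedProduct L S) := by
  refine NormedAddCommGroup.completeSpace_of_summable_imp_tendsto fun u hu => ?_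
  -- the partial sums of the pointwise norms converge in `L`
  let v : ℕ → G → ℂ := fun n => ∑ i ∈ Finset.range n, absFun (u i).fn
  have hv : ∀ n, v n ∈ L.carrier := fun n => L.carrier.sum_mem fun i _ => (u i).absFun_mem
  have hvx : ∀ n x, v n x = ((∑ i ∈ Finset.range n, ‖(u i).fn x‖ : ℝ) : ℂ) := fun n x => by
    simp [v, absFun]
  have hsub : ∀ n m, n ≤ m → L.nrm (v m - v n) ≤ ∑ i ∈ Finset.Ico n m, ‖u i‖ := fun n m h => by
    induction m, h using Nat.le_induction with
    | base => simp [L.nrm_zero]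
    | succ m h ih =>
      have e : v (m + 1) - v n = (v m - v n) + absFun (u m).fn := by
        simp only [v, Finset.sum_range_succ]; abel
      rw [e, Finset.sum_Ico_succ_top h]
      refine (L.nrm_add_le _ (L.carrier.sub_mem (hv m) (hv n)) _ (u m).absFun_mem).trans ?_
      exact add_le_add_left ih _
  obtain ⟨k, hk, hlim⟩ := L.complete v hv fun ε hε => by
    have hc := hu.hasSum.tendsto_sum_nat.cauchySeq
    obtain ⟨N, hN⟩ := Metric.cauchySeq_iff.1 hc ε hε
    have key : ∀ m ≥ N, ∀ n ≥ N, n ≤ m → L.nrm (v m - v n) < ε := fun m hm n hn h => by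
      refine (hsub n m h).trans_lt (lt_of_le_of_lt ?_ (hN m hm n hn))
      rw [Real.dist_eq, Finset.sum_Ico_eq_sub _ h]
      exact le_abs_self _
    refine ⟨N, fun m hm n hn => ?_⟩
    rcases le_total n m with h | h
    · exact key m hm n hn h
    · rw [L.nrm_sub_comm (hv m) (hv n)]; exact key n hn m hm h
  obtain ⟨C, hC0, hC⟩ := L.exists_l1_le
  have hpt : ∀ x, Filter.Tendsto (fun n => v n x) Filter.atTop (nhds (k x)) := fun x => by
    rw [tendsto_iff_norm_sub_tendsto_zero]
    refine squeeze_zero (fun _ => norm_nonneg _) (fun n => ?_) (by simpa using hlim.const_mul C)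
    have hm := L.carrier.sub_mem (hv n) hk
    exact (L.norm_apply_le_l1 hm x).trans (hC _ hm)
  have hre : ∀ x, Filter.Tendsto (fun n => ∑ i ∈ Finset.range n, ‖(u i).fn x‖) Filter.atTop
      (nhds (k x).re) := fun x => by
    refine ((Complex.continuous_re.tendsto _).comp (hpt x)).congr fun n => ?_
    simp only [Function.comp_apply, hvx, Complex.ofReal_re]
  have hs : ∀ x, HasSum (fun i => ‖(u i).fn x‖) (k x).re := fun x =>
    (hasSum_iff_tendsto_nat_of_nonneg (fun _ => norm_nonneg _) _).2 (hre x)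
  let F : G → A := fun x => ∑' i, (u i).fn x
  have hFk : ∀ x, ‖F x‖ ≤ ‖k x‖ := fun x =>
    (tsum_of_norm_bounded (hs x) fun _ => le_rfl).trans (Complex.re_le_norm _)
  have hF : absFun F ∈ L.carrier :=
    (L.solid _ k hk fun x => by rw [norm_absFun]; exact hFk x).1
  refine ⟨mk F hF, ?_⟩
  rw [tendsto_iff_norm_sub_tendsto_zero]
  refine squeeze_zero (fun _ => norm_nonneg _) (fun n => ?_) hlim
  refine norm_le_of_bound _ _ (L.carrier.sub_mem (hv n) hk) fun x => ?_
  have hsx : Summable fun i => (u i).fn x := (hs x).summable.of_norm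
  have e1 : ((∑ i ∈ Finset.range n, u i) - mk F hF : TwistedCrossedProduct L S).fn x =
      -∑' i, (u (i + n)).fn x := by
    rw [fn_sub, Pi.sub_apply, fn_sum, fn_mk]
    change _ - ∑' i, (u i).fn x = _
    rw [← hsx.sum_add_tsum_nat_add n]; abel
  rw [e1, norm_neg]
  have e2 : HasSum (fun i => ‖(u (i + n)).fn x‖)
      ((k x).re - ∑ i ∈ Finset.range n, ‖(u i).fn x‖) :=
    (hasSum_nat_add_iff' n).2 (hs x)
  refine (tsum_of_norm_bounded e2 fun _ => le_rfl).trans ?_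
  rw [Pi.sub_apply, norm_sub_rev]
  refine le_trans (le_of_eq ?_) (Complex.re_le_norm _)
  simp [hvx]

noncomputable instance : NonUnitalBanachStarAlgebra (TwistedCrossedProduct L S) where

end TwistedCrossedProduct

/-- The twisted crossed product `C⋆`-algebra `A ⋊ G`: the enveloping `C⋆`-algebra of the
`ℓ¹`-twisted crossed product. -/
abbrev TwistedCrossedProductCStar {G A : Type*} [Group G] [NonUnitalCStarAlgebra A]
    (S : TwistedSystem G A) : Type _ :=
  EnvelopingCStarAlgebra (TwistedCrossedProduct (AdmissibleAlgebra.l1 G) S)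

end CrossedProducts

section InverseClosed

/-- A `*`-subalgebra `S` of `C` is inverse closed if it contains the inverse of each of its
elements that is invertible in `C` (this concerns algebras `C` with a unit), and if the same holds
in the unitization of `C` for the algebra obtained from `S` by adjoining the unit, that is, for
quasi-inverses (this is the meaning of inverse closedness for algebras without unit). -/
structure IsInverseClosed {C : Type*} [NonUnitalRing C] [StarRing C] [Module ℂ C]
    (S : NonUnitalStarSubalgebra ℂ C) : Prop where
  inverse_mem : ∀ f ∈ S, ∀ g : C, (∀ c, f * g * c = c ∧ c * (f * g) = c) →
    (∀ c, g * f * c = c ∧ c * (g * f) = c) → g ∈ S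
  quasiInverse_mem : ∀ f ∈ S, ∀ g : C, g + f + f * g = 0 → f + g + g * f = 0 → g ∈ S

/-- In a unital algebra the first condition is the usual one. -/
theorem IsInverseClosed.of_mul_eq_one {C : Type*} [Ring C] [StarRing C] [Module ℂ C]
    {S : NonUnitalStarSubalgebra ℂ C} (h : IsInverseClosed S) {f g : C} (hf : f ∈ S)
    (h1 : f * g = 1) (h2 : g * f = 1) : g ∈ S :=
  h.inverse_mem f hf g (fun c => by simp [h1]) fun c => by simp [h2]

/-- For a subalgebra of a unital algebra that contains the unit, closedness under inverses in the
usual sense is all that is required. -/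
theorem isInverseClosed_iff {C : Type*} [Ring C] [StarRing C] [Algebra ℂ C]
    {S : NonUnitalStarSubalgebra ℂ C} (hS : (1 : C) ∈ S) :
    IsInverseClosed S ↔ ∀ f ∈ S, ∀ g : C, f * g = 1 → g * f = 1 → g ∈ S := by
  refine ⟨fun h f hf g h1 h2 => h.of_mul_eq_one hf h1 h2, fun h => ⟨fun f hf g h1 h2 => ?_,
    fun f hf g h1 h2 => ?_⟩⟩
  · exact h f hf g (by simpa using (h1 1).1) (by simpa using (h2 1).1)
  · have e1 : (1 + f) * (1 + g) = 1 + (g + f + f * g) := by noncomm_ring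
    have e2 : (1 + g) * (1 + f) = 1 + (f + g + g * f) := by noncomm_ring
    have := h (1 + f) (add_mem hS hf) (1 + g) (by rw [e1, h1, add_zero]) (by rw [e2, h2, add_zero])
    simpa using sub_mem this hS

end InverseClosed

/-- The discrete group `G` is rigidly `L`-symmetric if the Banach `*`-algebra `L(G; A)`, with the
untwisted convolution and involution, is symmetric for every `C⋆`-algebra `A`. -/
def IsRigidlySymmetric.{u, v} {G : Type u} [Group G] (L : AdmissibleAlgebra G) : Prop :=
  ∀ (A : Type (max u v)) [NonUnitalCStarAlgebra A],
    IsSymmetricBanachStarAlgebra (TwistedCrossedProduct L (TwistedSystem.trivial G A))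

/-- The discrete group `G` is TCP-rigidly `L`-symmetric if the Banach `*`-algebra
`L_{α,ω}(G; A)` is symmetric for every twisted `C⋆`-dynamical system `(A, α, ω)` over `G`. -/
def IsTCPRigidlySymmetric.{u, v} {G : Type u} [Group G] (L : AdmissibleAlgebra G) : Prop :=
  ∀ (A : Type (max u v)) [NonUnitalCStarAlgebra A] (S : TwistedSystem G A),
    IsSymmetricBanachStarAlgebra (TwistedCrossedProduct L S)

universe u v w

/-! Symmetry is carried over from the untwisted case by absorbing the twist into the coefficients.
In the crossed product `C⋆`-algebra A ⋊ G the elements a δ_x satisfy (a δ_x)(b δ_y) = a α_x(b)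
ω(x,y) δ_{xy}, so f ↦ (x ↦ f(x) δ_x) is a `*`-homomorphism of L_{α,ω}(G;A) to the untwisted algebra
L(G; A ⋊ G) (`untwist`), whose symmetry is the hypothesis. It is isometric because ‖a δ_x‖ = ‖a‖
(`norm_fiber`). An isometric homomorphism cannot change a spectrum that is real in the target, since
the complement of such a spectrum is connected; hence symmetry passes to L_{α,ω}(G;A)
(`IsSymmetricBanachStarAlgebra.of_isometry`).

The enveloping `C⋆`-algebra is controlled without constructing representations. In the unitization,
the infimum of the c with c² - b⋆b a finite sum of elements x⋆x is a `C⋆`-seminorm, hence at most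
the enveloping norm. It has two lower bounds. For every twisted system, evaluation at the unit of G
is positive, which gives ‖f(x)‖ ≤ `starBoundNorm (inr f)`; this yields both injectivity into the
envelope and the isometry of the fibres. For a symmetric algebra, a positive scalar plus a sum of
squares is invertible, so the spectrum of a self-adjoint element is bounded by the seminorm.

The second bound gives inverse closedness. If 1 + b becomes invertible in the envelope while
(1+b)⋆(1+b) = 1 + k is not invertible, then -1 lies in the spectrum of k; a polynomial p with p(0) =
0, p(-1) = -1 and p(k) of enveloping norm less than 1 contradicts the bound. Genuine inverses reduce
to quasi-inverses because a unit of the envelope, if there is one, comes from the crossed product.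
The statement in 𝔹(H) follows since an injective `*`-homomorphism of a `C⋆`-algebra has inverse
closed image. -/

section SquareRoots

/-! ### Self-adjoint square roots in unital Banach algebras with involution -/

open Filter Topology ENNReal NNReal

theorem sub_mem_spectrum_of_mem_spectrum_smul_one_sub {U : Type*} [Ring U] [Algebra ℂ U]
    (c : ℂ) (h : U) :
    ∀ z ∈ spectrum ℂ (c • 1 - h), c - z ∈ spectrum ℂ h :=
  fun z hz => by
  rw [← Algebra.algebraMap_eq_smul_one, ← spectrum.singleton_sub_eq] at hz
  obtain ⟨_, rfl, v, hv, rfl⟩ := hz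
  simpa using hv

variable {U : Type*} [NormedRing U] [NormedAlgebra ℂ U] [CompleteSpace U]

/-- Gelfand's formula gives ‖xⁿ‖ ≤ rⁿ eventually for some r < 1/4, and the Catalan numbers are at
most 4ⁿ, so a geometric series of ratio 4r < 1 dominates. Only the spectral radius matters; ‖x‖
itself may be large. -/
theorem summable_catalan_mul_norm_pow {x : U} (hx : spectralRadius ℂ x < ((1 / 4 : ℝ≥0) : ℝ≥0∞)) :
    Summable fun n : ℕ => ‖(catalan n : ℂ) • x ^ (n + 1)‖ := by
  obtain ⟨r, hr, hr4⟩ := ENNReal.lt_iff_exists_nnreal_btwn.1 hx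
  rw [ENNReal.coe_lt_coe] at hr4
  have hr4' : 4 * (r : ℝ) < 1 := by
    have : (r : ℝ) < ((1 / 4 : ℝ≥0) : ℝ) := hr4
    push_cast at this
    linarith
  have h1 := (spectrum.pow_nnnorm_pow_one_div_tendsto_nhds_spectralRadius x).eventually_lt_const hr
  have h2 : ∀ᶠ n : ℕ in atTop, ‖x ^ (n + 1)‖ ≤ (r : ℝ) ^ (n + 1) := by
    refine (tendsto_add_atTop_nat 1).eventually (p := fun n => ‖x ^ n‖ ≤ (r : ℝ) ^ n) ?_
    filter_upwards [h1, eventually_gt_atTop 0] with n hn hn0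
    have hn' := pow_le_pow_left₀ zero_le hn.le n
    rw [← ENNReal.rpow_natCast, ← ENNReal.rpow_mul,
      one_div_mul_cancel (by positivity), ENNReal.rpow_one] at hn'
    exact_mod_cast hn'
  refine Summable.of_norm_bounded_eventually_nat
    (summable_geometric_of_lt_one (r := 4 * (r : ℝ)) (by positivity) hr4') ?_
  filter_upwards [h2] with n hn
  have hc : (catalan n : ℝ) ≤ 4 ^ n := by
    have h3 := succ_mul_catalan_eq_centralBinom n
    have h4 := Nat.centralBinom_le_four_pow n
    have h5 : catalan n ≤ 4 ^ n := by nlinarith [Nat.zero_le (n * catalan n)]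
    exact_mod_cast h5
  have hr0 : (0 : ℝ) ≤ r := r.2
  have hr1 : (r : ℝ) ≤ 1 := by linarith
  rw [norm_norm, norm_smul, Complex.norm_natCast, mul_pow]
  refine mul_le_mul hc (hn.trans ?_) (norm_nonneg _) (by positivity)
  exact pow_le_pow_of_le_one hr0 hr1 (Nat.le_succ n)

/-- The solution is the generating series y = ∑ C_n x^(n+1) of the Catalan numbers: the recursion
C_(n+1) = ∑ C_i C_j over i + j = n says that its Cauchy square is y - x. The coefficients are real
and the involution is continuous, so y is self-adjoint. -/
theorem exists_eq_add_sq [StarRing U] [ContinuousStar U] [StarModule ℂ U]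
    {x : U} (hx : spectralRadius ℂ x < ((1 / 4 : ℝ≥0) : ℝ≥0∞)) (hs : IsSelfAdjoint x) :
    ∃ y : U, IsSelfAdjoint y ∧ y = x + y * y := by
  have hsum := summable_catalan_mul_norm_pow hx
  let u : ℕ → U := fun n => (catalan n : ℂ) • x ^ (n + 1)
  refine ⟨∑' n, u n, ?_, ?_⟩
  · rw [IsSelfAdjoint, tsum_star]
    refine tsum_congr fun n => ?_
    simp [u, hs.star_eq]
  · rw [tsum_mul_tsum_eq_tsum_sum_antidiagonal_of_summable_norm hsum hsum,
      hsum.of_norm.tsum_eq_zero_add]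
    congr 1
    · simp
    refine tsum_congr fun n => ?_
    rw [catalan_succ', Nat.cast_sum, Finset.sum_smul]
    refine Finset.sum_congr rfl fun p hp => ?_
    rw [Finset.HasAntidiagonal.mem_antidiagonal] at hp
    rw [smul_mul_smul_comm, ← pow_add, ← hp]
    push_cast
    congr 2
    ring

variable [Nontrivial U] [StarRing U] [ContinuousStar U] [StarModule ℂ U]

/-- With x = (1 - h)/4 and y = x + y², the element w = 1 - 2y satisfies w² = 1 - 4(y - y²) = 1 - 4x
= h. -/
theorem exists_isSelfAdjoint_sq_eq_of_spectrum_subset {h : U} (hs : IsSelfAdjoint h)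
    (hσ : ∀ z ∈ spectrum ℂ h, ‖1 - z‖ < 1) : ∃ w : U, IsSelfAdjoint w ∧ w * w = h := by
  have h4 : spectralRadius ℂ ((1 / 4 : ℂ) • (1 - h)) < ((1 / 4 : ℝ≥0) : ℝ≥0∞) := by
    refine spectrum.spectralRadius_lt_of_forall_lt _ fun z hz => ?_
    rw [spectrum.smul_eq_smul _ _ (spectrum.nonempty _)] at hz
    obtain ⟨w, hw, rfl⟩ := hz
    rw [← map_one (algebraMap ℂ U), ← spectrum.singleton_sub_eq] at hw
    obtain ⟨_, rfl, v, hv, rfl⟩ := hw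
    have := hσ v hv
    rw [← NNReal.coe_lt_coe]
    simp only [smul_eq_mul, coe_nnnorm, norm_mul]
    norm_num
    linarith
  obtain ⟨y, hy, hxy⟩ := exists_eq_add_sq h4 (by
    refine IsSelfAdjoint.smul ?_ ((IsSelfAdjoint.one U).sub hs)
    rw [IsSelfAdjoint]; simp)
  refine ⟨1 - (2 : ℂ) • y, (IsSelfAdjoint.one U).sub (IsSelfAdjoint.smul ?_ hy), ?_⟩
  · rw [IsSelfAdjoint]; simp
  · have e : (1 - (2 : ℂ) • y) * (1 - (2 : ℂ) • y) = 1 - (4 : ℂ) • (y - y * y) := by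
      simp only [sub_mul, mul_sub, one_mul, mul_one, smul_mul_assoc, mul_smul_comm]
      module
    have e2 : y - y * y = (1 / 4 : ℂ) • (1 - h) := by
      nth_rewrite 1 [hxy]; abel
    rw [e, e2, smul_smul]; norm_num

theorem exists_isSelfAdjoint_sq_eq_of_spectrum_subset_ball {h : U} (hs : IsSelfAdjoint h) {c : ℝ}
    (hc : 0 < c) (hσ : ∀ z ∈ spectrum ℂ h, ‖c - z‖ < c) : ∃ w : U, IsSelfAdjoint w ∧ w * w = h := by
  have hc0 : (c : ℂ) ≠ 0 := by exact_mod_cast hc.ne'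
  have hr : ∀ t : ℝ, IsSelfAdjoint (t : ℂ) := fun t => by rw [IsSelfAdjoint]; simp
  obtain ⟨w, hw, hwh⟩ := exists_isSelfAdjoint_sq_eq_of_spectrum_subset
    (h := ((c⁻¹ : ℝ) : ℂ) • h) (IsSelfAdjoint.smul (hr _) hs) fun z hz => by
      rw [spectrum.smul_eq_smul _ _ (spectrum.nonempty _)] at hz
      obtain ⟨v, hv, rfl⟩ := hz
      have e : (1 : ℂ) - ((c⁻¹ : ℝ) : ℂ) * v = (c : ℂ)⁻¹ * (c - v) := by
        push_cast; field_simp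
      simp only [smul_eq_mul]
      rw [e, norm_mul, norm_inv, Complex.norm_real, Real.norm_of_nonneg hc.le,
        inv_mul_lt_one₀ hc]
      exact hσ v hv
  refine ⟨((√c : ℝ) : ℂ) • w, IsSelfAdjoint.smul (hr _) hw, ?_⟩
  rw [smul_mul_smul_comm, hwh, smul_smul, ← Complex.ofReal_mul, Real.mul_self_sqrt hc.le,
    ← Complex.ofReal_mul, mul_inv_cancel₀ hc.ne', Complex.ofReal_one, one_smul]

theorem exists_isSelfAdjoint_sq_eq_of_norm_lt [NormOneClass U] {h : U} (hs : IsSelfAdjoint h)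
    {c : ℝ} (hc : ‖h‖ < c) : ∃ w : U, IsSelfAdjoint w ∧ w * w = (c : ℂ) • 1 - h := by
  refine exists_isSelfAdjoint_sq_eq_of_spectrum_subset_ball
    ((IsSelfAdjoint.smul (by rw [IsSelfAdjoint]; simp) (IsSelfAdjoint.one U)).sub hs)
    ((norm_nonneg _).trans_lt hc) fun z hz => ?_
  exact (spectrum.norm_le_norm_of_mem
    (sub_mem_spectrum_of_mem_spectrum_smul_one_sub _ _ z hz)).trans_lt hc

end SquareRoots

/-! ### The `C⋆`-seminorm defined by the cone of sums of squares -/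

section SquareCone

/-- The cone of finite sums of elements `x⋆ x`. -/
def squareCone (U : Type*) [Ring U] [StarRing U] : AddSubmonoid U :=
  AddSubmonoid.closure (Set.range fun x : U => star x * x)

section Algebraic

variable {U : Type*} [Ring U] [StarRing U]

theorem star_mul_self_mem_squareCone (x : U) : star x * x ∈ squareCone U :=
  AddSubmonoid.subset_closure ⟨x, rfl⟩

theorem star_mul_mul_mem_squareCone {k : U} (hk : k ∈ squareCone U) (y : U) :
    star y * k * y ∈ squareCone U := by
  induction hk using AddSubmonoid.closure_induction with
  | mem k hk =>
    obtain ⟨x, rfl⟩ := hk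
    have := star_mul_self_mem_squareCone (x * y)
    simpa only [star_mul, mul_assoc] using this
  | zero => simp [zero_mem]
  | add a b _ _ ha hb => simpa only [mul_add, add_mul] using add_mem ha hb

variable [Algebra ℂ U]

/-- The positive reals `c` with `b⋆ b ≤ c²` for the order given by the cone of sums of squares. -/
def starBounds (b : U) : Set ℝ :=
  {c | 0 < c ∧ ((c ^ 2 : ℝ) : ℂ) • 1 - star b * b ∈ squareCone U}

/-- The infimum of the `c ≥ 0` with `b⋆ b ≤ c²`. -/
noncomputable def starBoundNorm (b : U) : ℝ := sInf (starBounds b)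

theorem bddBelow_starBounds (b : U) : BddBelow (starBounds b) := ⟨0, fun _ h => h.1.le⟩

theorem starBoundNorm_nonneg (b : U) : 0 ≤ starBoundNorm b :=
  Real.sInf_nonneg fun _ h => h.1.le

theorem starBoundNorm_le {b : U} {c : ℝ} (h : c ∈ starBounds b) : starBoundNorm b ≤ c :=
  csInf_le (bddBelow_starBounds b) h

variable [StarModule ℂ U]

theorem smul_mem_squareCone {k : U} (hk : k ∈ squareCone U) {c : ℝ} (hc : 0 ≤ c) :
    (c : ℂ) • k ∈ squareCone U := by
  -- Multiplication by c ≥ 0 is conjugation by the scalar √c.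
  have h := star_mul_mul_mem_squareCone hk (((√c : ℝ) : ℂ) • (1 : U))
  simp only [star_smul, star_one, smul_mul_assoc, mul_smul_comm, one_mul, mul_one,
    smul_smul, Complex.star_def, Complex.conj_ofReal, ← Complex.ofReal_mul,
    Real.mul_self_sqrt hc] at h
  exact h

theorem smul_one_mem_squareCone {c : ℝ} (hc : 0 ≤ c) : (c : ℂ) • (1 : U) ∈ squareCone U :=
  smul_mem_squareCone (by simpa using star_mul_self_mem_squareCone (1 : U)) hc

theorem starBounds_upward {b : U} {c d : ℝ} (hc : c ∈ starBounds b) (h : c ≤ d) :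
    d ∈ starBounds b := by
  refine ⟨hc.1.trans_le h, ?_⟩
  have h1 := add_mem hc.2 (smul_one_mem_squareCone (U := U) (c := d ^ 2 - c ^ 2)
    (by nlinarith [hc.1]))
  convert h1 using 1
  push_cast
  module

theorem mem_starBounds_zero {c : ℝ} (hc : 0 < c) : c ∈ starBounds (0 : U) :=
  ⟨hc, by
    rw [star_zero, zero_mul, sub_zero]
    exact smul_one_mem_squareCone (by positivity)⟩

/-- Triangle inequality, from the identity (c+d)² - (a+b)⋆(a+b) = (1 + d/c)(c² - a⋆a) + (1 + c/d)(d²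
- b⋆b) + (cd)⁻¹(da - cb)⋆(da - cb). -/
theorem add_mem_starBounds {a b : U} {c d : ℝ} (ha : c ∈ starBounds a) (hb : d ∈ starBounds b) :
    c + d ∈ starBounds (a + b) := by
  obtain ⟨hc, ha⟩ := ha
  obtain ⟨hd, hb⟩ := hb
  refine ⟨by positivity, ?_⟩
  have h1 := smul_mem_squareCone ha (c := 1 + d / c) (by positivity)
  have h2 := smul_mem_squareCone hb (c := 1 + c / d) (by positivity)
  have h3 := smul_mem_squareCone (star_mul_self_mem_squareCone ((d : ℂ) • a - (c : ℂ) • b))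
    (c := (c * d)⁻¹) (by positivity)
  convert add_mem (add_mem h1 h2) h3 using 1
  have hc' : (c : ℂ) ≠ 0 := by exact_mod_cast hc.ne'
  have hd' : (d : ℂ) ≠ 0 := by exact_mod_cast hd.ne'
  simp only [star_sub, star_smul, star_add, Complex.star_def, Complex.conj_ofReal, mul_sub, sub_mul,
    mul_add, add_mul, smul_mul_assoc, mul_smul_comm]
  push_cast
  match_scalars <;> field_simp <;> ring

/-- Submultiplicativity, from c²d² - (ab)⋆(ab) = c²(d² - b⋆b) + b⋆(c² - a⋆a)b. -/
theorem mul_mem_starBounds {a b : U} {c d : ℝ} (ha : c ∈ starBounds a) (hb : d ∈ starBounds b) :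
    c * d ∈ starBounds (a * b) := by
  obtain ⟨hc, ha⟩ := ha
  obtain ⟨hd, hb⟩ := hb
  refine ⟨by positivity, ?_⟩
  convert add_mem (smul_mem_squareCone hb (c := c ^ 2) (by positivity))
    (star_mul_mul_mem_squareCone ha b) using 1
  simp only [star_mul, mul_sub, sub_mul, smul_mul_assoc, mul_smul_comm, mul_one, mul_assoc]
  push_cast
  match_scalars <;> ring

theorem smul_mem_starBounds {b : U} {c : ℝ} (hb : c ∈ starBounds b) {z : ℂ} (hz : z ≠ 0) :
    ‖z‖ * c ∈ starBounds (z • b) := by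
  obtain ⟨hc, hb⟩ := hb
  refine ⟨by positivity, ?_⟩
  convert smul_mem_squareCone hb (c := ‖z‖ ^ 2) (by positivity) using 1
  have hz' : z * star z = (‖z‖ : ℂ) ^ 2 := Complex.mul_conj' z
  simp only [star_smul, smul_mul_assoc, mul_smul_comm, smul_sub, smul_smul, hz']
  push_cast
  match_scalars <;> ring

/-- The nontrivial half of the `C⋆`-identity, from 2c²(c² - b⋆b) = (c² - b⋆b)² + (c⁴ - (b⋆b)²). -/
theorem mem_starBounds_of_sq {b : U} {c : ℝ} (hc : 0 < c)
    (hb : c ^ 2 ∈ starBounds (star b * b)) : c ∈ starBounds b := by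
  refine ⟨hc, ?_⟩
  have h1 := add_mem (star_mul_self_mem_squareCone (((c ^ 2 : ℝ) : ℂ) • 1 - star b * b)) hb.2
  convert smul_mem_squareCone h1 (c := (2 * c ^ 2)⁻¹) (by positivity) using 1
  have hc' : (c : ℂ) ≠ 0 := by exact_mod_cast hc.ne'
  simp only [star_sub, star_smul, star_one, star_mul, star_star, Complex.star_def,
    Complex.conj_ofReal, mul_sub, sub_mul, smul_mul_assoc, mul_smul_comm, mul_one, one_mul]
  push_cast
  match_scalars <;> field_simp <;> ring

theorem starBoundNorm_zero : starBoundNorm (0 : U) = 0 :=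
  le_antisymm (le_of_forall_pos_le_add fun ε hε => by
    exact (csInf_le (bddBelow_starBounds (0 : U)) (mem_starBounds_zero hε)).trans (by simp))
    (starBoundNorm_nonneg _)

end Algebraic

variable {U : Type*} [NormedRing U] [NormedAlgebra ℂ U] [CompleteSpace U] [Nontrivial U]
  [NormOneClass U] [StarRing U] [NormedStarGroup U] [StarModule ℂ U]

/-- Since ‖b⋆b‖ ≤ ‖b‖² < c², the element c² - b⋆b has a self-adjoint square root w, so it is the
square w⋆w. This is where completeness enters: it makes the set of bounds nonempty, so that its
infimum is meaningful. -/
theorem mem_starBounds_of_norm_lt {b : U} {c : ℝ} (h : ‖b‖ < c) : c ∈ starBounds b := by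
  have h0 : 0 ≤ ‖b‖ := norm_nonneg b
  refine ⟨h0.trans_lt h, ?_⟩
  obtain ⟨w, hw, hw2⟩ := exists_isSelfAdjoint_sq_eq_of_norm_lt (IsSelfAdjoint.star_mul_self b)
    (c := c ^ 2) (by
      refine (norm_mul_le _ _).trans_lt ?_
      rw [norm_star]; nlinarith)
  rw [← hw2]
  nth_rewrite 1 [← hw.star_eq]
  exact star_mul_self_mem_squareCone w

theorem nonempty_starBounds (b : U) : (starBounds b).Nonempty :=
  ⟨‖b‖ + 1, mem_starBounds_of_norm_lt (lt_add_one _)⟩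

theorem mem_starBounds {b : U} {c : ℝ} (h : starBoundNorm b < c) : c ∈ starBounds b := by
  obtain ⟨d, hd, hdc⟩ := (csInf_lt_iff (bddBelow_starBounds b) (nonempty_starBounds b)).1 h
  exact starBounds_upward hd hdc.le

theorem starBoundNorm_add_le (a b : U) :
    starBoundNorm (a + b) ≤ starBoundNorm a + starBoundNorm b := by
  refine le_of_forall_pos_le_add fun ε hε => ?_
  have := starBoundNorm_le (add_mem_starBounds
    (mem_starBounds (b := a) (lt_add_of_pos_right _ (half_pos hε)))
    (mem_starBounds (b := b) (lt_add_of_pos_right _ (half_pos hε))))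
  linarith

theorem starBoundNorm_smul_le (z : ℂ) (b : U) :
    starBoundNorm (z • b) ≤ ‖z‖ * starBoundNorm b := by
  rcases eq_or_ne z 0 with rfl | hz
  · simp [starBoundNorm_zero]
  · have hz0 : 0 < ‖z‖ := norm_pos_iff.2 hz
    rw [← div_le_iff₀' hz0]
    refine le_of_forall_gt_imp_ge_of_dense fun c hc => ?_
    rw [div_le_iff₀' hz0]
    exact starBoundNorm_le (smul_mem_starBounds (mem_starBounds hc) hz)

theorem starBoundNorm_mul_le (a b : U) :
    starBoundNorm (a * b) ≤ starBoundNorm a * starBoundNorm b := by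
  have h : Filter.Tendsto (fun ε : ℝ => (starBoundNorm a + ε) * (starBoundNorm b + ε))
      (nhdsWithin 0 (Set.Ioi 0)) (nhds (starBoundNorm a * starBoundNorm b)) := by
    have h0 : Continuous fun ε : ℝ => (starBoundNorm a + ε) * (starBoundNorm b + ε) := by fun_prop
    simpa using (h0.tendsto 0).mono_left nhdsWithin_le_nhds
  refine ge_of_tendsto h ?_
  filter_upwards [self_mem_nhdsWithin] with ε hε
  exact starBoundNorm_le (mul_mem_starBounds (mem_starBounds (lt_add_of_pos_right _ hε))
    (mem_starBounds (lt_add_of_pos_right _ hε)))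

theorem starBoundNorm_sq_le (b : U) : starBoundNorm b ^ 2 ≤ starBoundNorm (star b * b) := by
  refine le_of_forall_gt_imp_ge_of_dense fun c hc => ?_
  have hc0 : 0 < c := (starBoundNorm_nonneg _).trans_lt hc
  have h := starBoundNorm_le (mem_starBounds_of_sq (Real.sqrt_pos.2 hc0)
    (by rw [Real.sq_sqrt hc0.le]; exact mem_starBounds hc))
  exact (pow_le_pow_left₀ (starBoundNorm_nonneg b) h 2).trans (Real.sq_sqrt hc0.le).le

/-- Write ‖·‖ for the seminorm. Cancel ‖b‖ in ‖b‖² ≤ ‖b⋆b‖ ≤ ‖b⋆‖‖b‖. The cone gives no direct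
comparison of b⋆b with bb⋆. -/
theorem starBoundNorm_le_star (b : U) : starBoundNorm b ≤ starBoundNorm (star b) := by
  rcases (starBoundNorm_nonneg b).eq_or_lt with h | h
  · rw [← h]; exact starBoundNorm_nonneg _
  · have := (starBoundNorm_sq_le b).trans (starBoundNorm_mul_le _ _)
    nlinarith

theorem starBoundNorm_star (b : U) : starBoundNorm (star b) = starBoundNorm b :=
  le_antisymm (by simpa using starBoundNorm_le_star (star b)) (starBoundNorm_le_star b)

theorem starBoundNorm_star_mul_self (b : U) :
    starBoundNorm (star b * b) = starBoundNorm b ^ 2 := by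
  refine le_antisymm ((starBoundNorm_mul_le _ _).trans ?_) (starBoundNorm_sq_le b)
  rw [starBoundNorm_star, sq]

end SquareCone

/-! ### The `ℓ¹`-unitization and the comparison with the enveloping norm -/

section Unitization

variable {B : Type*} [NonUnitalBanachStarAlgebra B]

/-- The unitization of a Banach `*`-algebra, with the `ℓ¹`-norm. -/
abbrev L1Unitization (B : Type*) [NonUnitalBanachStarAlgebra B] : Type _ :=
  WithLp 1 (Unitization ℂ B)

namespace L1Unitization

instance : StarRing (L1Unitization B) where
  star x := WithLp.toLp 1 (star (WithLp.ofLp x))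
  star_involutive x := congrArg (WithLp.toLp 1) (star_star (WithLp.ofLp x))
  star_mul x y := congrArg (WithLp.toLp 1) (star_mul (WithLp.ofLp x) (WithLp.ofLp y))
  star_add x y := congrArg (WithLp.toLp 1) (star_add (WithLp.ofLp x) (WithLp.ofLp y))

theorem ofLp_star (x : L1Unitization B) : WithLp.ofLp (star x) = star (WithLp.ofLp x) := rfl

instance : StarModule ℂ (L1Unitization B) where
  star_smul c x := congrArg (WithLp.toLp 1) (star_smul c (WithLp.ofLp x))

instance : NormedStarGroup (L1Unitization B) where
  norm_star_le x := by
    rw [WithLp.unitization_norm_def, WithLp.unitization_norm_def, ofLp_star,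
      Unitization.fst_star, Unitization.snd_star, norm_star, norm_star]

instance : NormOneClass (L1Unitization B) where
  norm_one := by
    rw [WithLp.unitization_norm_def]
    change ‖(1 : Unitization ℂ B).fst‖ + ‖(1 : Unitization ℂ B).snd‖ = 1
    simp

instance : Nontrivial (L1Unitization B) := NormOneClass.nontrivial

/-- The inclusion of a Banach `*`-algebra in its unitization. -/
def inr : B →⋆ₙₐ[ℂ] L1Unitization B where
  toFun b := WithLp.toLp 1 (b : Unitization ℂ B)
  map_smul' c b := congrArg (WithLp.toLp 1) (Unitization.inr_smul ℂ c b)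
  map_zero' := rfl
  map_add' a b := congrArg (WithLp.toLp 1) (Unitization.inr_add ℂ a b)
  map_mul' a b := congrArg (WithLp.toLp 1) (Unitization.inr_mul ℂ a b)
  map_star' b := congrArg (WithLp.toLp 1) (Unitization.inr_star b)

theorem ofLp_inr (b : B) : WithLp.ofLp (inr b) = (b : Unitization ℂ B) := rfl

theorem inr_injective : Function.Injective (inr : B → L1Unitization B) := fun _ _ h =>
  Unitization.inr_injective (congrArg WithLp.ofLp h)

theorem exists_eq_smul_one_add_inr (x : L1Unitization B) : ∃ (z : ℂ) (b : B), x = z • 1 + inr b := by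
  refine ⟨(WithLp.ofLp x).fst, (WithLp.ofLp x).snd, WithLp.ofLp_injective 1 ?_⟩
  rw [WithLp.ofLp_add, WithLp.ofLp_smul, ofLp_inr]
  nth_rewrite 1 [← Unitization.inl_fst_add_inr_snd_eq (WithLp.ofLp x)]
  congr 1
  change _ = _ • (1 : Unitization ℂ B)
  rw [← Unitization.algebraMap_eq_inl, Algebra.algebraMap_eq_smul_one]

theorem norm_smul_one_add_inr (c : ℂ) (b : B) : ‖c • 1 + inr b‖ = ‖c‖ + ‖b‖ := by
  rw [WithLp.unitization_norm_def, WithLp.ofLp_add, WithLp.ofLp_smul, ofLp_inr]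
  change ‖(c • (1 : Unitization ℂ B) + (b : Unitization ℂ B)).fst‖ +
    ‖(c • (1 : Unitization ℂ B) + (b : Unitization ℂ B)).snd‖ = _
  simp

theorem mul_inr_mem_range (x : L1Unitization B) (b : B) : ∃ a, x * inr b = inr a := by
  obtain ⟨z, c, rfl⟩ := exists_eq_smul_one_add_inr x
  exact ⟨z • b + c * b, by rw [map_add, map_smul, map_mul, add_mul, smul_mul_assoc, one_mul]⟩

theorem inr_mul_mem_range (x : L1Unitization B) (b : B) : ∃ a, inr b * x = inr a := by
  obtain ⟨z, c, rfl⟩ := exists_eq_smul_one_add_inr x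
  exact ⟨z • b + b * c, by rw [map_add, map_smul, map_mul, mul_add, mul_smul_comm, mul_one]⟩

theorem spectrum_inr (b : B) : spectrum ℂ (inr b) = quasispectrum ℂ b := by
  rw [Unitization.quasispectrum_eq_spectrum_inr ℂ b]
  exact (AlgEquiv.spectrum_eq (WithLp.unitizationAlgEquiv ℂ :
    WithLp 1 (Unitization ℂ B) ≃ₐ[ℂ] Unitization ℂ B) (inr b)).symm

theorem isQuasiregular_iff_isUnit_one_add_inr (b : B) : IsQuasiregular b ↔ IsUnit (1 + inr b) := by
  rw [isQuasiregular_iff_isUnit' ℂ]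
  exact MulEquiv.isUnit_map (WithLp.unitizationAlgEquiv ℂ :
    WithLp 1 (Unitization ℂ B) ≃ₐ[ℂ] Unitization ℂ B)

end L1Unitization

open L1Unitization

variable (B) in
/-- The `C⋆`-seminorm of a Banach `*`-algebra that is given by its cone of sums of squares. -/
noncomputable def squareSeminorm : CStarSeminorm B where
  toSeminorm := Seminorm.ofSMulLE (fun b => starBoundNorm (inr b))
    (by rw [map_zero, starBoundNorm_zero])
    (fun a b => by rw [map_add]; exact starBoundNorm_add_le _ _)
    (fun c b => by rw [map_smul]; exact starBoundNorm_smul_le _ _)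
  mul_le' a b := by
    change starBoundNorm (inr (a * b)) ≤ _
    rw [map_mul]; exact starBoundNorm_mul_le _ _
  star_mul_self' a := by
    change starBoundNorm (inr (star a * a)) = _
    rw [map_mul, map_star]; exact starBoundNorm_star_mul_self _

theorem norm_toEnveloping (b : B) :
    ‖toEnveloping B b‖ = (CStarSeminorm.greatest B).toSeminorm b :=
  CStarSeminorm.CStarCompletion.norm_of _ b

theorem norm_toEnveloping_le (b : B) : ‖toEnveloping B b‖ ≤ ‖b‖ :=
  (norm_toEnveloping b).trans_le (CStarSeminorm.apply_le_norm _ b)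

/-- The cone seminorm is one of the `C⋆`-seminorms over which the enveloping norm is the supremum.
Lower bounds for the enveloping norm are all obtained through this comparison. -/
theorem starBoundNorm_le_norm_toEnveloping (b : B) :
    starBoundNorm (inr b) ≤ ‖toEnveloping B b‖ := by
  rw [norm_toEnveloping]
  exact le_ciSup (CStarSeminorm.bddAbove_apply b) (squareSeminorm B)

theorem denseRange_toEnveloping : DenseRange (toEnveloping B) :=
  CStarSeminorm.CStarCompletion.denseRange_of _

end Unitization

/-! ### Spectral bounds in symmetric algebras -/

section Symmetric

open L1Unitization

variable {U : Type*} [NormedRing U] [NormedAlgebra ℂ U] [CompleteSpace U] [Nontrivial U]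
  [NormOneClass U] [StarRing U] [NormedStarGroup U] [StarModule ℂ U]

/-- In a symmetric unital Banach `*`-algebra, `1 + x⋆ x = v⋆ v` with `v` invertible. -/
theorem exists_isUnit_one_add_star_mul_self
    (hU : ∀ x : U, ∀ z ∈ spectrum ℂ (star x * x), 0 ≤ z.re ∧ z.im = 0) (x : U) :
    ∃ v : U, IsUnit v ∧ 1 + star x * x = star v * v := by
  have hσ : ∀ z ∈ spectrum ℂ (1 + star x * x), 1 ≤ z.re ∧ z.im = 0 ∧ ‖z‖ ≤ ‖1 + star x * x‖ :=
    fun z hz => by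
      refine ⟨?_, ?_, spectrum.norm_le_norm_of_mem hz⟩ <;>
      · rw [← map_one (algebraMap ℂ U), ← spectrum.singleton_add_eq] at hz
        obtain ⟨_, rfl, v, hv, rfl⟩ := hz
        have := hU x v hv
        simp [this.1, this.2]
  set h := 1 + star x * x with hh
  have hs : IsSelfAdjoint h := (IsSelfAdjoint.one U).add (IsSelfAdjoint.star_mul_self x)
  -- The spectrum of h lies in [1, ‖h‖], hence in the open disc of centre and radius ‖h‖ + 1.
  obtain ⟨w, hw, hw2⟩ := exists_isSelfAdjoint_sq_eq_of_spectrum_subset_ball hs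
    (c := ‖h‖ + 1) (by positivity) fun z hz => by
      obtain ⟨h1, h2, h3⟩ := hσ z hz
      have e : z = (z.re : ℂ) := Complex.ext rfl (by simpa using h2)
      rw [e, Complex.norm_real, Real.norm_of_nonneg (by linarith)] at h3
      rw [e, ← Complex.ofReal_sub, Complex.norm_real, Real.norm_of_nonneg (by linarith)]
      linarith
  have hu : IsUnit h := by
    rw [← spectrum.zero_notMem_iff ℂ]
    intro h0
    have := (hσ 0 h0).1
    norm_num at this
  refine ⟨w, ?_, by rw [hw.star_eq, hw2]⟩
  rw [← hw2] at hu
  exact isUnit_pow_iff two_ne_zero |>.1 (by rwa [sq])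

/-- One square is absorbed by w⋆w + x⋆x = w⋆(1 + (xw⁻¹)⋆(xw⁻¹))w. The statement quantifies over all
invertible w so that a sum can be absorbed one summand at a time, the v of one step being the w of
the next. -/
theorem exists_isUnit_star_mul_self_add_of_mem_squareCone
    (hU : ∀ x : U, ∀ z ∈ spectrum ℂ (star x * x), 0 ≤ z.re ∧ z.im = 0)
    {k : U} (hk : k ∈ squareCone U) :
    ∀ w : U, IsUnit w → ∃ v : U, IsUnit v ∧ star w * w + k = star v * v := by
  induction hk using AddSubmonoid.closure_induction with
  | mem k hk =>
    obtain ⟨x, rfl⟩ := hk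
    rintro _ ⟨w, rfl⟩
    obtain ⟨v, hv, e⟩ := exists_isUnit_one_add_star_mul_self hU (x * (w⁻¹ : Uˣ))
    refine ⟨v * w, hv.mul w.isUnit, ?_⟩
    have e1 : star (w : U) * star ((w⁻¹ : Uˣ) : U) = 1 := by
      rw [← star_mul, Units.inv_mul, star_one]
    calc star (w : U) * w + star x * x
        = star (w : U) * w + (star (w : U) * star ((w⁻¹ : Uˣ) : U)) * (star x * x) *
          (((w⁻¹ : Uˣ) : U) * w) := by rw [e1, Units.inv_mul]; simp
      _ = star (w : U) * (1 + star (x * (w⁻¹ : Uˣ)) * (x * (w⁻¹ : Uˣ))) * w := by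
        rw [star_mul]; noncomm_ring
      _ = star (v * w) * (v * w) := by rw [e, star_mul]; noncomm_ring
  | zero => exact fun w hw => ⟨w, hw, by simp⟩
  | add a b _ _ ha hb =>
    intro w hw
    obtain ⟨v, hv, e⟩ := ha w hw
    obtain ⟨u, hu, e'⟩ := hb v hv
    exact ⟨u, hu, by rw [← add_assoc, e, e']⟩

/-- The preceding lemma with w = √t. Symmetry concerns single squares x⋆x; this extends its
consequence to sums of squares. -/
theorem isUnit_smul_one_add_of_mem_squareCone
    (hU : ∀ x : U, ∀ z ∈ spectrum ℂ (star x * x), 0 ≤ z.re ∧ z.im = 0)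
    {k : U} (hk : k ∈ squareCone U) {t : ℝ} (ht : 0 < t) : IsUnit ((t : ℂ) • 1 + k) := by
  have hs : ((√t : ℝ) : ℂ) ≠ 0 := by exact_mod_cast (Real.sqrt_pos.2 ht).ne'
  obtain ⟨v, hv, e⟩ := exists_isUnit_star_mul_self_add_of_mem_squareCone hU hk
    (((√t : ℝ) : ℂ) • 1) (by
      rw [← Algebra.algebraMap_eq_smul_one]; exact (isUnit_iff_ne_zero.2 hs).map _)
  rw [star_smul, star_one, smul_mul_smul_comm, one_mul, Complex.star_def, Complex.conj_ofReal,
    ← Complex.ofReal_mul, Real.mul_self_sqrt ht.le] at e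
  rw [e]
  exact hv.star.mul hv

/-- A spectral value z is real. If z > c², then z - b⋆b = (z - c²) + (c² - b⋆b) is a positive scalar
plus an element of the cone, hence invertible. -/
theorem re_le_of_mem_starBounds
    (hU : ∀ x : U, ∀ z ∈ spectrum ℂ (star x * x), 0 ≤ z.re ∧ z.im = 0)
    {b : U} {c : ℝ} (hc : c ∈ starBounds b) {z : ℂ} (hz : z ∈ spectrum ℂ (star b * b)) :
    z.re ≤ c ^ 2 := by
  by_contra! h
  have e : z = (z.re : ℂ) := Complex.ext rfl (by simpa using (hU b z hz).2)
  have h1 := isUnit_smul_one_add_of_mem_squareCone hU hc.2 (sub_pos.2 h)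
  rw [spectrum.mem_iff, Algebra.algebraMap_eq_smul_one, e] at hz
  refine hz ?_
  convert h1 using 1
  push_cast
  module

/-- Apply the bound for b⋆b to z² in the spectrum of h⋆h = h²; by symmetry z² ≥ 0, so z² = |z|². -/
theorem norm_le_starBoundNorm_of_isSelfAdjoint
    (hU : ∀ x : U, ∀ z ∈ spectrum ℂ (star x * x), 0 ≤ z.re ∧ z.im = 0)
    {h : U} (hs : IsSelfAdjoint h) {z : ℂ} (hz : z ∈ spectrum ℂ h) : ‖z‖ ≤ starBoundNorm h := by
  refine le_of_forall_gt_imp_ge_of_dense fun c hc => ?_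
  have hc0 : 0 < c := (starBoundNorm_nonneg _).trans_lt hc
  have h2 : z ^ 2 ∈ spectrum ℂ (star h * h) := by
    rw [hs.star_eq, ← sq]
    exact spectrum.pow_mem_pow h 2 hz
  have h3 := re_le_of_mem_starBounds hU (mem_starBounds hc) h2
  have h4 := hU h _ h2
  have e : z ^ 2 = ((z ^ 2).re : ℂ) := Complex.ext rfl (by simpa using h4.2)
  have h5 : ‖z‖ ^ 2 = (z ^ 2).re := by
    rw [← norm_pow, e, Complex.norm_real, Real.norm_of_nonneg h4.1, ← e]
  rw [← h5] at h3
  exact le_of_sq_le_sq h3 hc0.le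

variable {B : Type*} [NonUnitalBanachStarAlgebra B]

/-- The square of z lies in the spectrum of h⋆h = h², so z² ≥ 0 and z is real. -/
theorem IsSymmetricBanachStarAlgebra.im_eq_zero (hB : IsSymmetricBanachStarAlgebra B) {h : B}
    (hs : IsSelfAdjoint h) {z : ℂ} (hz : z ∈ spectrum ℂ (inr h)) : z.im = 0 := by
  have h2 : z ^ 2 ∈ spectrum ℂ (inr (star h * h)) := by
    rw [hs.star_eq, map_mul, ← sq]
    exact spectrum.pow_mem_pow _ 2 hz
  rw [L1Unitization.spectrum_inr] at h2
  have h3 := hB h _ h2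
  simp only [sq, Complex.mul_re, Complex.mul_im] at h3
  by_contra h0
  have h4 : z.re = 0 := by
    have : z.re * z.im = 0 := by linarith [h3.2]
    exact (mul_eq_zero.1 this).resolve_right h0
  rw [h4] at h3
  have := mul_self_pos.2 h0
  linarith [h3.1]

/-- For x = c + b one has x⋆x = |c|² + k with k self-adjoint in B, so the spectrum is real. To
exclude a value z < 0, multiply by k to return to B: for y = xk, the element y⋆y = (|c|² + k)k² has
the spectral value z(z - |c|²)² < 0, against the symmetry of B. -/
theorem IsSymmetricBanachStarAlgebra.unitization (hB : IsSymmetricBanachStarAlgebra B)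
    (x : L1Unitization B) : ∀ z ∈ spectrum ℂ (star x * x), 0 ≤ z.re ∧ z.im = 0 := by
  intro z hz
  obtain ⟨c, b, hx⟩ := L1Unitization.exists_eq_smul_one_add_inr x
  let k : B := star c • b + c • star b + star b * b
  have hk : IsSelfAdjoint k := by
    rw [IsSelfAdjoint]; simp [k, add_comm]
  have hxk : star x * x = ((‖c‖ ^ 2 : ℝ) : ℂ) • 1 + inr k := by
    have hc : star c * c = ((‖c‖ ^ 2 : ℝ) : ℂ) := by
      push_cast; exact Complex.conj_mul' c
    rw [← hc, hx]
    simp only [k, map_add, map_smul, map_mul, map_star, star_add, star_smul, star_one, add_mul,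
      mul_add, smul_mul_assoc, mul_smul_comm, one_mul, mul_one]
    module
  have hzk : z - ((‖c‖ ^ 2 : ℝ) : ℂ) ∈ spectrum ℂ (inr k) := by
    rw [hxk, ← Algebra.algebraMap_eq_smul_one, ← spectrum.singleton_add_eq] at hz
    obtain ⟨_, rfl, v, hv, rfl⟩ := hz
    simpa using hv
  have him : z.im = 0 := by
    simpa only [Complex.sub_im, Complex.ofReal_im, sub_zero] using hB.im_eq_zero hk hzk
  refine ⟨?_, him⟩
  by_contra! hneg
  obtain ⟨y, hy⟩ := L1Unitization.mul_inr_mem_range x k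
  have hyk : inr (star y * y) = Polynomial.aeval (inr k)
      ((Polynomial.C ((‖c‖ ^ 2 : ℝ) : ℂ) + Polynomial.X) * Polynomial.X ^ 2) := by
    rw [map_mul, map_star, ← hy, star_mul, ← map_star, hk.star_eq]
    simp only [map_mul, map_add, map_pow, Polynomial.aeval_X, Polynomial.aeval_C,
      Algebra.algebraMap_eq_smul_one]
    rw [← hxk]
    have hcomm : inr k * (star x * x) = (star x * x) * inr k := by
      rw [hxk]; simp [mul_add, add_mul]
    calc inr k * star x * (x * inr k) = (inr k * (star x * x)) * inr k := by noncomm_ring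
      _ = _ := by rw [hcomm]; noncomm_ring
  have h1 := spectrum.subset_polynomial_aeval (inr k) ((Polynomial.C ((‖c‖ ^ 2 : ℝ) : ℂ) +
    Polynomial.X) * Polynomial.X ^ 2) ⟨_, hzk, rfl⟩
  rw [← hyk, L1Unitization.spectrum_inr] at h1
  have h2 := (hB y _ h1).1
  have e : z = (z.re : ℂ) := Complex.ext rfl (by simpa using him)
  have hn : 0 ≤ ‖c‖ ^ 2 := by positivity
  simp only [Polynomial.eval_mul, Polynomial.eval_add, Polynomial.eval_C, Polynomial.eval_X,
    Polynomial.eval_pow] at h2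
  rw [e, ← Complex.ofReal_sub, ← Complex.ofReal_add, ← Complex.ofReal_pow, ← Complex.ofReal_mul,
    Complex.ofReal_re] at h2
  have h3 : 0 < (z.re - ‖c‖ ^ 2) ^ 2 := by
    have : z.re - ‖c‖ ^ 2 ≠ 0 := by linarith
    positivity
  nlinarith

theorem IsSymmetricBanachStarAlgebra.norm_le_of_mem_spectrum (hB : IsSymmetricBanachStarAlgebra B)
    {h : B} (hs : IsSelfAdjoint h) {z : ℂ} (hz : z ∈ spectrum ℂ (inr h)) :
    ‖z‖ ≤ ‖toEnveloping B h‖ :=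
  (norm_le_starBoundNorm_of_isSelfAdjoint hB.unitization (hs.map inr) hz).trans
    (starBoundNorm_le_norm_toEnveloping h)

end Symmetric

/-! ### Quasi-inverses in the enveloping `C⋆`-algebra -/

section InverseClosedness

open L1Unitization

open scoped ComplexOrder in

-- The spectrum of the positive invertible element T = u⋆u lies in (0, ‖T‖], so that of 1 - T/‖T‖
-- lies in [0, 1); for a self-adjoint element the norm is the spectral radius.
theorem norm_one_sub_smul_star_mul_self_lt {D : Type*} [CStarAlgebra D] [Nontrivial D] {u : D}
    (hu : IsUnit u) : ‖1 - ((‖star u * u‖⁻¹ : ℝ) : ℂ) • (star u * u)‖ < 1 := by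
  let _ := CStarAlgebra.spectralOrder D
  have := CStarAlgebra.spectralOrderedRing D
  set T := star u * u with hT
  have hTu : IsUnit T := hu.star.mul hu
  have hT0 : 0 < ‖T‖ := norm_pos_iff.2 hTu.ne_zero
  have hs : IsSelfAdjoint (1 - ((‖T‖⁻¹ : ℝ) : ℂ) • T) :=
    (IsSelfAdjoint.one D).sub
      (IsSelfAdjoint.smul (by rw [IsSelfAdjoint]; simp) (IsSelfAdjoint.star_mul_self u))
  have h := spectrum.spectralRadius_lt_of_forall_lt (1 - ((‖T‖⁻¹ : ℝ) : ℂ) • T) (r := 1)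
    fun z hz => by
      rw [← map_one (algebraMap ℂ D), ← spectrum.singleton_sub_eq] at hz
      obtain ⟨_, rfl, w, hw, rfl⟩ := hz
      rw [spectrum.smul_eq_smul _ _ (spectrum.nonempty _)] at hw
      obtain ⟨v, hv, rfl⟩ := hw
      have hv0 : v ≠ 0 := by
        rintro rfl
        exact spectrum.zero_notMem ℂ hTu hv
      have hvn := spectrum.norm_le_norm_of_mem hv
      have hvp := spectrum_nonneg_of_nonneg (star_mul_self_nonneg u) hv
      rw [Complex.nonneg_iff] at hvp
      have e : v = (v.re : ℂ) := Complex.ext rfl (by simpa using hvp.2.symm)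
      have hre : 0 < v.re := lt_of_le_of_ne hvp.1 fun h => hv0 (by rw [e, ← h]; simp)
      rw [e, Complex.norm_real, Real.norm_of_nonneg hvp.1] at hvn
      rw [← NNReal.coe_lt_coe, coe_nnnorm, e]
      have e2 : (1 : ℂ) - ((‖T‖⁻¹ : ℝ) : ℂ) • (v.re : ℂ) = ((1 - ‖T‖⁻¹ * v.re : ℝ) : ℂ) := by
        simp
      have h1 : ‖T‖⁻¹ * v.re ≤ 1 := by rwa [inv_mul_le_one₀ hT0]
      have h2 : 0 < ‖T‖⁻¹ * v.re := by positivity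
      change ‖(1 : ℂ) - ((‖T‖⁻¹ : ℝ) : ℂ) • (v.re : ℂ)‖ < 1
      rw [e2, Complex.norm_real, Real.norm_of_nonneg (by linarith)]
      simpa using h2
  rw [hs.spectralRadius_eq_nnnorm, ENNReal.coe_lt_coe] at h
  exact_mod_cast h

variable {B : Type*} [NonUnitalBanachStarAlgebra B]

/-- Write (1+b)⋆(1+b) = 1 + k. If this is not invertible, then -1 is in the spectrum of k. The
polynomial p = X(1 - r(1 + X))ⁿ has p(-1) = -1, so the bound `hφ` forces ‖φ(p(k))‖ ≥ 1. But 1 + φ(k)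
is positive and invertible, so ‖1 - r(1 + φ(k))‖ < 1 for a suitable r, and ‖φ(p(k))‖ < 1 for large
n. -/
theorem isUnit_star_one_add_inr_mul_self {C : Type*} [NonUnitalCStarAlgebra C] (φ : B →⋆ₙₐ[ℂ] C)
    (hφ : ∀ h : B, IsSelfAdjoint h → ∀ z ∈ spectrum ℂ (inr h), ‖z‖ ≤ ‖φ h‖) {b : B}
    (hb : IsQuasiregular (φ b)) : IsUnit (star (1 + inr b) * (1 + inr b)) := by
  let ψ : L1Unitization B →ₐ[ℂ] Unitization ℂ C :=
    (Unitization.starMap φ : Unitization ℂ B →⋆ₐ[ℂ] Unitization ℂ C).toAlgHom.comp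
      (WithLp.unitizationAlgEquiv ℂ : WithLp 1 (Unitization ℂ B) ≃ₐ[ℂ] Unitization ℂ B).toAlgHom
  have hψ : ∀ a, ψ (inr a) = (φ a : Unitization ℂ C) := fun a => Unitization.starMap_inr φ a
  obtain ⟨k, hkb⟩ : ∃ k : B, k = b + star b + star b * b := ⟨_, rfl⟩
  have hk : IsSelfAdjoint k := by rw [IsSelfAdjoint]; simp [hkb, add_comm]
  have hbk : star (1 + inr b) * (1 + inr b) = 1 + inr k := by
    simp only [hkb, map_add, map_mul, map_star, star_add, star_one]
    noncomm_ring
  let u : Unitization ℂ C := 1 + φ b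
  have hu : IsUnit u := (isQuasiregular_iff_isUnit' ℂ).1 hb
  have hT : star u * u = 1 + φ k := by
    simp only [u, hkb, map_add, map_mul, map_star, star_add, star_one, Unitization.inr_add,
      Unitization.inr_mul, Unitization.inr_star]
    noncomm_ring
  let r : ℂ := ((‖star u * u‖⁻¹ : ℝ) : ℂ)
  have hρ : ‖1 - r • (1 + (φ k : Unitization ℂ C))‖ < 1 := by
    rw [← hT]; exact norm_one_sub_smul_star_mul_self_lt hu
  obtain ⟨n, hn⟩ : ∃ n : ℕ, ‖φ k‖ * ‖1 - r • (1 + (φ k : Unitization ℂ C))‖ ^ n < 1 := by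
    have := (tendsto_pow_atTop_nhds_zero_of_lt_one (norm_nonneg _) hρ).const_mul ‖φ k‖
    rw [mul_zero] at this
    exact (this.eventually_lt_const one_pos).exists
  let M : L1Unitization B := (1 - r • (1 + inr k)) ^ n
  have hM : IsSelfAdjoint M := by
    refine IsSelfAdjoint.pow ((IsSelfAdjoint.one _).sub (IsSelfAdjoint.smul ?_
      ((IsSelfAdjoint.one _).add (hk.map inr)))) n
    rw [IsSelfAdjoint]; simp [r]
  have hcomm : Commute (inr k) M := by
    refine Commute.pow_right ?_ n
    refine (Commute.one_right _).sub_right (Commute.smul_right ?_ r)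
    exact (Commute.one_right _).add_right (Commute.refl _)
  -- The factor k keeps p(k) in B, where `hφ` is available; a is p(k).
  obtain ⟨a, ha⟩ := inr_mul_mem_range M k
  have has : IsSelfAdjoint a := inr_injective (by
    rw [map_star, ← ha]
    exact ((hk.map inr).commute_iff hM).1 hcomm)
  have hna : ‖φ a‖ < 1 := by
    have e : ((φ a : C) : Unitization ℂ C) = φ k * (1 - r • (1 + (φ k : Unitization ℂ C))) ^ n := by
      rw [← hψ, ← ha, map_mul, hψ, map_pow, map_sub, map_smul, map_add, map_one, hψ]
    rw [← Unitization.norm_inr (𝕜 := ℂ), e]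
    refine (norm_mul_le _ _).trans_lt (lt_of_le_of_lt ?_ hn)
    rw [Unitization.norm_inr]
    exact mul_le_mul_of_nonneg_left (norm_pow_le _ _) (norm_nonneg _)
  rw [hbk]
  have hspec : (-1 : ℂ) ∉ spectrum ℂ (inr k) := fun h => by
    let q : Polynomial ℂ := Polynomial.X * (1 - Polynomial.C r * (1 + Polynomial.X)) ^ n
    have h1 := spectrum.subset_polynomial_aeval (inr k) q ⟨_, h, rfl⟩
    have hq : Polynomial.aeval (inr k) q = inr a := by
      rw [← ha]
      simp [q, M, Algebra.smul_def]
    rw [hq] at h1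
    have h2 := hφ a has _ h1
    simp only [q, Polynomial.eval_mul, Polynomial.eval_X, Polynomial.eval_pow, Polynomial.eval_sub,
      Polynomial.eval_add, Polynomial.eval_one, Polynomial.eval_C, add_neg_cancel, mul_zero,
      sub_zero, one_pow, mul_one, norm_neg, norm_one] at h2
    exact absurd hna (not_lt.2 h2)
  rw [spectrum.notMem_iff, map_neg, map_one, ← IsUnit.neg_iff] at hspec
  convert hspec using 1
  abel

/-- A symmetric Banach `*`-algebra is closed under quasi-inverses in its enveloping
`C⋆`-algebra. -/
theorem IsSymmetricBanachStarAlgebra.isQuasiregular_of_toEnveloping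
    (hB : IsSymmetricBanachStarAlgebra B) {b : B} (hb : IsQuasiregular (toEnveloping B b)) :
    IsQuasiregular b := by
  rw [isQuasiregular_iff_isUnit_one_add_inr]
  -- Invertibility of (1+b)⋆(1+b) only gives a left inverse of 1 + b; the same result for b⋆ gives a
  -- right inverse.
  have hb' : IsQuasiregular (toEnveloping B (star b)) := by
    rw [isQuasiregular_iff_isUnit' ℂ] at hb ⊢
    have := hb.star
    rwa [star_add, star_one, ← Unitization.inr_star, ← map_star] at this
  have h1 := isUnit_star_one_add_inr_mul_self _ (fun _ h _ => hB.norm_le_of_mem_spectrum h) hb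
  have h2 := isUnit_star_one_add_inr_mul_self _ (fun _ h _ => hB.norm_le_of_mem_spectrum h) hb'
  have e : star (1 + inr (star b)) = 1 + inr b := by
    rw [star_add, star_one, map_star, star_star]
  rw [e] at h2
  have h3 : (h1.unit⁻¹ : (L1Unitization B)ˣ) * star (1 + inr b) * (1 + inr b) = 1 := by
    rw [mul_assoc]; exact h1.val_inv_mul
  have h4 : (1 + inr b) * ((1 + inr (star b)) * (h2.unit⁻¹ : (L1Unitization B)ˣ)) = 1 := by
    rw [← mul_assoc]; exact h2.mul_val_inv
  exact ⟨⟨1 + inr b, _, left_inv_eq_right_inv h3 h4 ▸ h4, h3⟩, rfl⟩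

/-- A left inverse 1 + g of 1 + f equals a right inverse 1 + h; the computation is written without a
unit. -/
theorem eq_of_quasiInverse {C : Type*} [NonUnitalRing C] {f g h : C}
    (hg : f + g + g * f = 0) (hh : h + f + f * h = 0) : g = h := by
  have h1 : f * h = g * f := by
    have h2 : (f + g + g * f) * h - g * (h + f + f * h) = f * h - g * f := by noncomm_ring
    rw [hg, hh, zero_mul, mul_zero, sub_self] at h2
    exact (sub_eq_zero.1 h2.symm)
  have h3 : g - h = (f + g + g * f) - (h + f + f * h) := by rw [h1]; abel
  rwa [hg, hh, sub_self, sub_eq_zero] at h3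

theorem IsSymmetricBanachStarAlgebra.quasiInverse_mem_range
    (hB : IsSymmetricBanachStarAlgebra B) {f g : EnvelopingCStarAlgebra B}
    (hf : f ∈ NonUnitalStarAlgHom.range (toEnveloping B)) (h1 : g + f + f * g = 0)
    (h2 : f + g + g * f = 0) : g ∈ NonUnitalStarAlgHom.range (toEnveloping B) := by
  obtain ⟨b, rfl⟩ := hf
  obtain ⟨c, hc1, -⟩ := isQuasiregular_iff.1
    (hB.isQuasiregular_of_toEnveloping (isQuasiregular_iff.2 ⟨g, h1, h2⟩))
  refine ⟨c, (eq_of_quasiInverse h2 ?_).symm⟩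
  have h3 := congrArg (toEnveloping B) hc1
  simp only [map_add, map_mul, map_zero] at h3
  exact h3

/-! ### Inverse closedness of images of `C⋆`-algebras -/

section Permanence

variable {C D : Type*} [NonUnitalCStarAlgebra C] [CStarAlgebra D] (Φ : C →⋆ₙₐ[ℂ] D)

theorem mem_range_starLift_iff {d : D} :
    d ∈ (Unitization.starLift Φ).range ↔ ∃ (z : ℂ) (c : C), d = z • 1 + Φ c := by
  constructor
  · rintro ⟨x, rfl⟩
    refine ⟨x.fst, x.snd, ?_⟩
    change algebraMap ℂ D x.fst + Φ x.snd = _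
    rw [Algebra.algebraMap_eq_smul_one]
  · rintro ⟨z, c, rfl⟩
    refine ⟨Unitization.inl z + (c : Unitization ℂ C), ?_⟩
    change algebraMap ℂ D (Unitization.inl z + (c : Unitization ℂ C)).fst +
      Φ (Unitization.inl z + (c : Unitization ℂ C)).snd = _
    rw [Algebra.algebraMap_eq_smul_one]
    simp

/-- An injective `*`-homomorphism of `C⋆`-algebras is isometric, so its image is closed, and adding
the line ℂ1 to a closed subspace keeps it closed. -/
theorem isClosed_range_starLift (hΦ : Function.Injective Φ) :
    IsClosed ((Unitization.starLift Φ).range : Set D) := by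
  have h1 : IsClosed (LinearMap.range (Φ : C →ₗ[ℂ] D) : Set D) :=
    (NonUnitalStarAlgHom.isometry Φ hΦ).isClosedEmbedding.isClosed_range
  have h2 := Submodule.isClosed_sup_finiteDimensional _ (Submodule.span ℂ {(1 : D)}) h1
  convert h2 using 1
  ext d
  rw [SetLike.mem_coe, mem_range_starLift_iff, SetLike.mem_coe, Submodule.mem_sup]
  simp only [Submodule.mem_span_singleton]
  constructor
  · rintro ⟨z, c, rfl⟩
    exact ⟨Φ c, ⟨c, rfl⟩, z • 1, ⟨z, rfl⟩, add_comm _ _⟩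
  · rintro ⟨_, ⟨c, rfl⟩, _, ⟨z, rfl⟩, rfl⟩
    exact ⟨z, c, add_comm _ _⟩

/-- Spectral permanence for the closed unital `*`-subalgebra ℂ1 + Φ(C) of D. -/
theorem exists_eq_smul_one_add_of_mul_eq_one (hΦ : Function.Injective Φ) {z : ℂ} {c : C} {d : D}
    (h1 : (z • 1 + Φ c) * d = 1) (h2 : d * (z • 1 + Φ c) = 1) :
    ∃ (w : ℂ) (e : C), d = w • 1 + Φ e := by
  have := isClosed_range_starLift Φ hΦ
  let x : (Unitization.starLift Φ).range := ⟨_, (mem_range_starLift_iff Φ).2 ⟨z, c, rfl⟩⟩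
  have hx : IsUnit (x : D) := ⟨⟨_, d, h1, h2⟩, rfl⟩
  obtain ⟨u, hu⟩ := (StarSubalgebra.coe_isUnit _).1 hx
  have h3 : (x : D) * ((u⁻¹ : (Unitization.starLift Φ).rangeˣ) : D) = 1 := by
    rw [← hu]
    exact congrArg Subtype.val u.mul_inv
  have h4 : d = ((u⁻¹ : (Unitization.starLift Φ).rangeˣ) : D) := left_inv_eq_right_inv h2 h3
  exact (mem_range_starLift_iff Φ).1 (h4 ▸ Subtype.property _)

/-- The image of a `C⋆`-algebra under an injective `*`-homomorphism is closed under inverses. -/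
theorem exists_eq_of_mul_eq_one (hΦ : Function.Injective Φ) {c : C} {d : D}
    (h1 : Φ c * d = 1) (h2 : d * Φ c = 1) : ∃ e, Φ e = d := by
  obtain ⟨w, e, hd⟩ := exists_eq_smul_one_add_of_mul_eq_one Φ hΦ (z := 0) (c := c) (d := d)
    (by simpa using h1) (by simpa using h2)
  -- Since 1 = Φ(c)d lies in the image of Φ, the scalar part w of d does too.
  have h3 : Φ (w • c + c * e) = 1 := by
    rw [← h1, hd, map_add, map_smul, map_mul, mul_add, mul_smul_comm, mul_one]
  exact ⟨w • (w • c + c * e) + e, by rw [map_add, map_smul, h3, ← hd]⟩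

/-- The image of a `C⋆`-algebra under an injective `*`-homomorphism is closed under
quasi-inverses. -/
theorem exists_eq_of_quasiInverse (hΦ : Function.Injective Φ) {c : C} {d : D}
    (h1 : d + Φ c + Φ c * d = 0) (h2 : Φ c + d + d * Φ c = 0) : ∃ e, Φ e = d := by
  have e1 : ((1 : ℂ) • 1 + Φ c) * (1 + d) = 1 + (d + Φ c + Φ c * d) := by
    rw [one_smul]; noncomm_ring
  have e2 : (1 + d) * ((1 : ℂ) • 1 + Φ c) = 1 + (Φ c + d + d * Φ c) := by
    rw [one_smul]; noncomm_ring
  obtain ⟨w, e, hd⟩ := exists_eq_smul_one_add_of_mul_eq_one Φ hΦ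
    (by rw [e1, h1, add_zero]) (by rw [e2, h2, add_zero])
  refine ⟨-(w • c + c * e), ?_⟩
  -- The inverse 1 + d is w + Φ(e); the factor Φ(c) moves it into the image of Φ.
  have h3 : d = -(Φ c * (1 + d)) := by
    rw [mul_add, mul_one, eq_neg_iff_add_eq_zero, ← add_assoc, h1]
  rw [h3, hd, map_neg, map_add, map_smul, map_mul, mul_add, mul_smul_comm, mul_one]

/-- An inverse closed subalgebra of a `C⋆`-algebra has inverse closed images under injective
`*`-homomorphisms. -/
theorem IsInverseClosed.comp {B : Type*} [NonUnitalBanachStarAlgebra B] (φ : B →⋆ₙₐ[ℂ] C)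
    (hφ : IsInverseClosed (NonUnitalStarAlgHom.range φ)) (hΦ : Function.Injective Φ) :
    IsInverseClosed (NonUnitalStarAlgHom.range (Φ.comp φ)) where
  inverse_mem := by
    rintro _ ⟨b, rfl⟩ g h1 h2
    change ∀ c, Φ (φ b) * g * c = c ∧ c * (Φ (φ b) * g) = c at h1
    change ∀ c, g * Φ (φ b) * c = c ∧ c * (g * Φ (φ b)) = c at h2
    obtain ⟨e, rfl⟩ := exists_eq_of_mul_eq_one Φ hΦ (by simpa using (h1 1).1)
      (by simpa using (h2 1).1)
    obtain ⟨a, ha⟩ := hφ.inverse_mem (φ b) ⟨b, rfl⟩ e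
      (fun c => ⟨hΦ (by simpa using (h1 (Φ c)).1), hΦ (by simpa using (h1 (Φ c)).2)⟩)
      (fun c => ⟨hΦ (by simpa using (h2 (Φ c)).1), hΦ (by simpa using (h2 (Φ c)).2)⟩)
    exact ⟨a, congrArg Φ ha⟩
  quasiInverse_mem := by
    rintro _ ⟨b, rfl⟩ g h1 h2
    change g + Φ (φ b) + Φ (φ b) * g = 0 at h1
    change Φ (φ b) + g + g * Φ (φ b) = 0 at h2
    obtain ⟨e, rfl⟩ := exists_eq_of_quasiInverse Φ hΦ h1 h2
    obtain ⟨a, ha⟩ := hφ.quasiInverse_mem (φ b) ⟨b, rfl⟩ e (hΦ (by simpa using h1))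
      (hΦ (by simpa using h2))
    exact ⟨a, congrArg Φ ha⟩

end Permanence

end InverseClosedness

/-! ### Real spectra under isometric homomorphisms, and descent of symmetry -/

section SpectralPermanence

open L1Unitization

/-- The complement of a bounded closed set of real numbers in the complex plane is connected. -/
theorem isPreconnected_compl_of_im_eq_zero {K : Set ℂ} (hK : Bornology.IsBounded K)
    (h : ∀ z ∈ K, z.im = 0) : IsPreconnected Kᶜ := by
  -- Each of the two parts lies between an open half-plane and its closure, hence is connected; they
  -- meet in a real point outside the bounded set K.
  have e : Kᶜ = (Kᶜ ∩ {z | 0 ≤ z.im}) ∪ (Kᶜ ∩ {z | z.im ≤ 0}) := by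
    rw [← Set.inter_union_distrib_left]
    ext z
    simp [le_total]
  rw [e]
  refine (IsConnected.union ?nonempty ?upper ?lower).isPreconnected
  case nonempty =>
    have := Filter.NeBot.nonempty_of_mem inferInstance <| Filter.mem_map.mp <|
      Complex.isometry_ofReal.antilipschitz.tendsto_cobounded hK.compl
    exact this.image Complex.ofReal |>.mono <| by simp
  case' upper => apply Complex.isConnected_of_upperHalfPlane ?_ <| Set.inter_subset_right
  case' lower => apply Complex.isConnected_of_lowerHalfPlane ?_ <| Set.inter_subset_right
  all_goals
    refine Set.subset_inter (fun z hz hz' ↦ ?_) (fun z hz ↦ by simpa using le_of_lt hz)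
    have := h z hz'
    simp_all

/-- Isometric homomorphisms of Banach algebras preserve real spectra. -/
theorem spectrum_eq_of_isometry {U V : Type*} [NormedRing U] [NormedAlgebra ℂ U] [CompleteSpace U]
    [NormedRing V] [NormedAlgebra ℂ V] [CompleteSpace V] (ψ : U →ₐ[ℂ] V) (hψ : Isometry ψ)
    {x : U} (hx : ∀ z ∈ spectrum ℂ (ψ x), z.im = 0) : spectrum ℂ x = spectrum ℂ (ψ x) := by
  have hcl : IsClosed (ψ.range : Set V) := hψ.isClosedEmbedding.isClosed_range
  let e : U ≃ₐ[ℂ] ψ.range := AlgEquiv.ofInjective ψ hψ.injective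
  rw [← AlgEquiv.spectrum_eq e x]
  -- Passing to a closed subalgebra can only fill holes of the spectrum, and a connected complement
  -- leaves none.
  exact Subalgebra.spectrum_eq_of_isPreconnected_compl ψ.range (e x)
    (isPreconnected_compl_of_im_eq_zero (spectrum.isBounded _) hx)

variable {B D : Type*} [NonUnitalBanachStarAlgebra B] [NonUnitalBanachStarAlgebra D]

/-- A Banach `*`-algebra with an isometric `*`-homomorphism to a symmetric one is symmetric. -/
theorem IsSymmetricBanachStarAlgebra.of_isometry (hD : IsSymmetricBanachStarAlgebra D)
    (θ : B →⋆ₙₐ[ℂ] D) (hθ : ∀ b, ‖θ b‖ = ‖b‖) : IsSymmetricBanachStarAlgebra B := by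
  intro b z hz
  let ψ : L1Unitization B →ₐ[ℂ] L1Unitization D :=
    (WithLp.unitizationAlgEquiv ℂ :
      WithLp 1 (Unitization ℂ D) ≃ₐ[ℂ] Unitization ℂ D).symm.toAlgHom.comp
      ((Unitization.starMap θ : Unitization ℂ B →⋆ₐ[ℂ] Unitization ℂ D).toAlgHom.comp
      (WithLp.unitizationAlgEquiv ℂ : WithLp 1 (Unitization ℂ B) ≃ₐ[ℂ] Unitization ℂ B).toAlgHom)
  have hinr : ∀ a, ψ (inr a) = inr (θ a) := fun a =>
    congrArg (WithLp.toLp 1) (Unitization.starMap_inr θ a)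
  -- The `ℓ¹`-norm |c| + ‖a‖ on the unitizations makes the extension of θ isometric as well.
  have hψ : Isometry ψ := AddMonoidHomClass.isometry_of_norm ψ fun x => by
    obtain ⟨c, a, rfl⟩ := exists_eq_smul_one_add_inr x
    rw [map_add, map_smul, map_one, hinr]
    rw [norm_smul_one_add_inr, norm_smul_one_add_inr, hθ]
  have h1 := hD (θ b)
  rw [← map_star, ← map_mul, ← L1Unitization.spectrum_inr, ← hinr] at h1
  rw [← L1Unitization.spectrum_inr, spectrum_eq_of_isometry ψ hψ fun z hz => (h1 z hz).2] at hz
  exact h1 z hz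

end SpectralPermanence

/-! ### Twisted convolution with functions supported at the unit -/

namespace TwistedSystem

open DoubleCentralizer
open scoped MultiplierAlgebra

variable {G A : Type*} [Group G] [NonUnitalCStarAlgebra A] (S : TwistedSystem G A)

theorem α_one (a : A) : S.α 1 a = a := by
  apply EquivLike.injective (S.α 1)
  apply coe_injective'
  rw [S.action, ω_one_left]; simp

theorem term_one_left (w : G) (a b : A) : S.term 1 w a b = a * b := by
  rw [term, S.ω_one_left, α_one]
  rfl

theorem term_one_right (y : G) (a b : A) : S.term y 1 a b = a * S.α y b := by
  rw [term, S.ω_one_right]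
  rfl

theorem term_zero_left (y w : G) (b : A) : S.term y w 0 b = 0 := (S.termL y w b).map_zero

theorem term_zero_right (y w : G) (a : A) : S.term y w a 0 = 0 := (S.termR y w a).map_zero

theorem trivial_term (y w : G) (a b : A) : (trivial G A).term y w a b = a * b := rfl

theorem trivial_involution (f : G → A) (x : G) : (trivial G A).involution f x = star (f x⁻¹) := by
  change (star (1 : 𝓜(ℂ, A))).fst (star (f x⁻¹)) = _
  rw [star_one]
  rfl

theorem convolution_single_one (f : G → A) (a : A) [DecidableEq G] (x : G) :
    S.convolution f (Pi.single 1 a) x = f x * S.α x a := by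
  rw [convolution, tsum_eq_single x]
  · rw [inv_mul_cancel, Pi.single_eq_same, term_one_right]
  · intro y hy
    rw [Pi.single_eq_of_ne (by rwa [Ne, inv_mul_eq_one]), term_zero_right]

theorem single_one_convolution (f : G → A) (a : A) [DecidableEq G] (x : G) :
    S.convolution (Pi.single 1 a) f x = a * f x := by
  rw [convolution, tsum_eq_single 1]
  · rw [Pi.single_eq_same, inv_one, one_mul, term_one_left]
  · intro y hy
    rw [Pi.single_eq_of_ne hy, term_zero_left]

theorem involution_single_one (a : A) [DecidableEq G] :
    S.involution (Pi.single 1 a) = Pi.single 1 (star a) := by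
  funext x
  rcases eq_or_ne x 1 with rfl | hx
  · rw [involution, inv_one, Pi.single_eq_same, Pi.single_eq_same, S.ω_one_left, α_one]
    change (star (1 : 𝓜(ℂ, A))).fst (star a) = _
    rw [star_one]; rfl
  · rw [involution, Pi.single_eq_of_ne (inv_ne_one.2 hx), Pi.single_eq_of_ne hx]
    simp

/-- The value of `f ⋄ f^⋄` at the unit. -/
theorem convolution_involution_one (f : G → A) :
    S.convolution f (S.involution f) 1 = ∑' y, f y * star (f y) := by
  refine tsum_congr fun y => ?_
  apply coe_injective'
  have h := S.coe_map_involution y y⁻¹ f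
  rw [mul_one, coe_term, h, S.action, mapAut_star]
  -- This is ω(y, y⁻¹) = α_y(ω(y⁻¹, y)), by which the twists of product and involution cancel.
  have h1 := S.cocycle y y⁻¹ y
  simp only [mul_inv_cancel, inv_mul_cancel, ω_one_left, ω_one_right, OneMemClass.coe_one,
    mul_one] at h1
  rw [inv_inv, mul_inv_cancel, α_one, ← h1, coe_mul', coe_star']
  simp only [star_mul, star_star, mul_assoc, star_ω_mul, mul_one]
  rw [← mul_assoc (star (S.ω y y⁻¹ : 𝓜(ℂ, A))), star_ω_mul, one_mul]

end TwistedSystem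

/-! ### Evaluation at the unit, injectivity, and inverse closedness in the envelope -/

namespace TwistedCrossedProduct

open L1Unitization

variable {G A : Type*} [Group G] [NonUnitalCStarAlgebra A] {L : AdmissibleAlgebra G}
  {S : TwistedSystem G A}

open Classical in
/-- The function with value `a` at the unit and `0` elsewhere. -/
noncomputable def unitFiber (L : AdmissibleAlgebra G) (S : TwistedSystem G A) (a : A) :
    TwistedCrossedProduct L S :=
  mk (Pi.single 1 a) (L.solid _ _ (L.carrier.smul_mem (‖a‖ : ℂ) L.one_mem) fun x => by
    rw [norm_absFun]
    rcases eq_or_ne x 1 with rfl | hx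
    · simp
    · simp [Pi.single_eq_of_ne hx]).1

theorem fn_unitFiber [DecidableEq G] (a : A) : (unitFiber L S a).fn = Pi.single 1 a := by
  classical
  rw [unitFiber, fn_mk]
  congr!

theorem mul_unitFiber (f : TwistedCrossedProduct L S) (a : A) (x : G) :
    (f * unitFiber L S a).fn x = f.fn x * S.α x a := by
  classical
  rw [fn_mul, fn_unitFiber, S.convolution_single_one]

theorem unitFiber_mul (f : TwistedCrossedProduct L S) (a : A) (x : G) :
    (unitFiber L S a * f).fn x = a * f.fn x := by
  classical
  rw [fn_mul, fn_unitFiber, S.single_one_convolution]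

theorem star_unitFiber (a : A) : star (unitFiber L S a) = unitFiber L S (star a) := by
  classical
  apply ext
  rw [fn_star, fn_unitFiber, fn_unitFiber, S.involution_single_one]

theorem mul_star_fn_one (f : TwistedCrossedProduct L S) :
    (f * star f).fn 1 = ∑' y, f.fn y * star (f.fn y) := by
  rw [fn_mul, fn_star, S.convolution_involution_one]

section Order

variable [PartialOrder A] [StarOrderedRing A]

theorem mul_star_fn_one_nonneg (f : TwistedCrossedProduct L S) : 0 ≤ (f * star f).fn 1 := by
  rw [mul_star_fn_one]
  exact tsum_nonneg fun y => mul_star_self_nonneg _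

theorem fn_mul_star_le (f : TwistedCrossedProduct L S) (x : G) :
    f.fn x * star (f.fn x) ≤ (f * star f).fn 1 := by
  rw [mul_star_fn_one]
  refine Summable.le_tsum ?_ x fun y _ => mul_star_self_nonneg _
  have h := f.summable
  refine Summable.of_norm_bounded (h.mul_right (∑' y, ‖f.fn y‖)) fun y => ?_
  rw [CStarRing.norm_self_mul_star]
  exact mul_le_mul_of_nonneg_left (h.le_tsum y fun _ _ => norm_nonneg _) (norm_nonneg _)

/-- Positivity of evaluation at the unit, extended to the cone of the unitization. Conjugation by y
returns to the crossed product: (xy)⋆(xy) = z⋆z, whose value at the unit is a sum of elements aa⋆ of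
A. -/
theorem exists_eq_inr_of_mem_squareCone {k : L1Unitization (TwistedCrossedProduct L S)}
    (hk : k ∈ squareCone _) (y : TwistedCrossedProduct L S) :
    ∃ v : TwistedCrossedProduct L S, star (inr y) * k * inr y = inr v ∧ 0 ≤ v.fn 1 := by
  induction hk using AddSubmonoid.closure_induction with
  | mem k hk =>
    obtain ⟨x, rfl⟩ := hk
    obtain ⟨z, hz⟩ := mul_inr_mem_range x y
    refine ⟨star z * z, ?_, ?_⟩
    · rw [map_mul, map_star, ← hz, star_mul]; noncomm_ring
    · have := mul_star_fn_one_nonneg (star z)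
      rwa [star_star] at this
  | zero => exact ⟨0, by simp, le_of_eq (by rw [fn_zero]; rfl)⟩
  | add a b _ _ ha hb =>
    obtain ⟨v, hv, hv0⟩ := ha
    obtain ⟨w, hw, hw0⟩ := hb
    exact ⟨v + w, by rw [mul_add, add_mul, hv, hw, map_add], add_nonneg hv0 hw0⟩

/-- Substitute for P ≤ c², where P is the value of f f^⋄ at the unit, when A has no unit: conjugate
c² - f f^⋄ by a δ_1 and evaluate at the unit. -/
theorem conjugate_fn_one_le {f : TwistedCrossedProduct L S} {c : ℝ}
    (hc : c ∈ starBounds (inr (star f))) (a : A) :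
    star a * (f * star f).fn 1 * a ≤ ((c ^ 2 : ℝ) : ℂ) • (star a * a) := by
  obtain ⟨v, hv, hv0⟩ := exists_eq_inr_of_mem_squareCone hc.2 (unitFiber L S a)
  have e : v = ((c ^ 2 : ℝ) : ℂ) • (unitFiber L S (star a) * unitFiber L S a) -
      unitFiber L S (star a) * ((f * star f) * unitFiber L S a) := by
    apply inr_injective
    rw [← hv, ← star_unitFiber]
    simp only [map_sub, map_smul, map_mul, map_star, star_star, mul_sub, sub_mul, mul_smul_comm,
      smul_mul_assoc, mul_one, mul_assoc]
  rw [e, fn_sub, fn_smul, Pi.sub_apply, Pi.smul_apply, unitFiber_mul, unitFiber_mul, mul_unitFiber,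
    S.α_one, sub_nonneg, ← mul_assoc] at hv0
  classical
  rwa [fn_unitFiber, Pi.single_eq_same] at hv0

/-- Taking a = P in the preceding inequality gives P³ ≤ c²P², hence ‖P‖⁴ = ‖P³P‖ ≤ c²‖P‖³. -/
theorem norm_mul_star_fn_one_le {f : TwistedCrossedProduct L S} {c : ℝ}
    (hc : c ∈ starBounds (inr (star f))) : ‖(f * star f).fn 1‖ ≤ c ^ 2 := by
  set P := (f * star f).fn 1 with hP
  have hP0 : 0 ≤ P := mul_star_fn_one_nonneg f
  have hs : star P = P := (IsSelfAdjoint.of_nonneg hP0).star_eq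
  have h1 := conjugate_fn_one_le hc P
  have h2 : 0 ≤ star P * P * P := star_left_conjugate_nonneg hP0 P
  have h3 := CStarAlgebra.norm_le_norm_of_nonneg_of_le h2 h1
  have hn : ‖P * P‖ = ‖P‖ * ‖P‖ := by
    nth_rewrite 1 [← hs]; exact CStarRing.norm_star_mul_self
  have hn2 : ‖(P * P) * (P * P)‖ = (‖P‖ * ‖P‖) * (‖P‖ * ‖P‖) := by
    rw [← hn]
    have : star (P * P) = P * P := by rw [star_mul, hs]
    nth_rewrite 1 [← this]
    exact CStarRing.norm_star_mul_self
  rw [norm_smul, hs, hn, Complex.norm_real, Real.norm_of_nonneg (by positivity)] at h3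
  have h4 : ‖(P * P) * (P * P)‖ ≤ ‖P * P * P‖ * ‖P‖ := by
    rw [← mul_assoc]; exact norm_mul_le _ _
  rw [hn2] at h4
  by_contra! hlt
  have h0 : 0 < ‖P‖ := (by positivity : (0 : ℝ) ≤ c ^ 2).trans_lt hlt
  have h5 : ‖P * P * P‖ * ‖P‖ ≤ c ^ 2 * (‖P‖ * ‖P‖) * ‖P‖ :=
    mul_le_mul_of_nonneg_right h3 h0.le
  have h6 : c ^ 2 * (‖P‖ * ‖P‖ * ‖P‖) < ‖P‖ * (‖P‖ * ‖P‖ * ‖P‖) :=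
    mul_lt_mul_of_pos_right hlt (by positivity)
  linarith

end Order

/-- The norms of the values of `f` are at most the norm of `f` in the enveloping `C⋆`-algebra. -/
theorem norm_fn_le_starBoundNorm (f : TwistedCrossedProduct L S) (x : G) :
    ‖f.fn x‖ ≤ starBoundNorm (inr f) := by
  let _ := CStarAlgebra.spectralOrder A
  have := CStarAlgebra.spectralOrderedRing A
  -- The bounds of f^⋄ are the ones that control f f^⋄, whose value at the unit dominates every
  -- f(x)f(x)⋆.
  rw [← starBoundNorm_star, ← map_star]
  refine le_of_forall_gt_imp_ge_of_dense fun c hc => ?_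
  have hc' := mem_starBounds hc
  have h := CStarAlgebra.norm_le_norm_of_nonneg_of_le (mul_star_self_nonneg _) (fn_mul_star_le f x)
  rw [CStarRing.norm_self_mul_star, ← sq] at h
  exact le_of_sq_le_sq (h.trans (norm_mul_star_fn_one_le hc')) hc'.1.le

theorem norm_fn_le_norm_toEnveloping (f : TwistedCrossedProduct L S) (x : G) :
    ‖f.fn x‖ ≤ ‖toEnveloping _ f‖ :=
  (norm_fn_le_starBoundNorm f x).trans (starBoundNorm_le_norm_toEnveloping f)

theorem toEnveloping_injective :
    Function.Injective (toEnveloping (TwistedCrossedProduct L S)) := by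
  refine (injective_iff_map_eq_zero _).2 fun f hf => ext (funext fun x => ?_)
  have h := norm_fn_le_norm_toEnveloping f x
  rw [hf, norm_zero] at h
  exact norm_le_zero_iff.1 h

/-- If the enveloping `C⋆`-algebra has a unit, it comes from the crossed product. -/
theorem unit_mem_range_toEnveloping {e : EnvelopingCStarAlgebra (TwistedCrossedProduct L S)}
    (he : ∀ c, e * c = c ∧ c * e = c) :
    e ∈ NonUnitalStarAlgHom.range (toEnveloping (TwistedCrossedProduct L S)) := by
  let φ := toEnveloping (TwistedCrossedProduct L S)
  obtain ⟨b, hb⟩ : ∃ b : ℕ → TwistedCrossedProduct L S,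
      Filter.Tendsto (fun n => φ (b n)) Filter.atTop (nhds e) := by
    obtain ⟨u, hu, hlim⟩ := mem_closure_iff_seq_limit.1 (denseRange_toEnveloping e)
    choose b hb using hu
    exact ⟨b, by simpa only [φ, hb] using hlim⟩
  -- Evaluation at the unit is contractive for the enveloping norm, so approximants of e have values
  -- converging in A; their limit u turns out to be a left unit of A.
  have hcau : CauchySeq fun n => (b n).fn 1 := by
    refine Metric.cauchySeq_iff.2 fun ε hε => ?_
    obtain ⟨N, hN⟩ := Metric.cauchySeq_iff.1 hb.cauchySeq ε hε
    refine ⟨N, fun m hm n hn => lt_of_le_of_lt ?_ (hN m hm n hn)⟩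
    rw [dist_eq_norm, dist_eq_norm, ← map_sub]
    exact norm_fn_le_norm_toEnveloping (b m - b n) 1
  obtain ⟨u, hu⟩ := cauchySeq_tendsto_of_complete hcau
  have hua : ∀ a : A, u * a = a := fun a => by
    refine tendsto_nhds_unique (hu.mul_const a) ?_
    -- The value of b_n (a δ_1) at the unit is b_n(1)a, and b_n (a δ_1) tends to a δ_1 in the
    -- envelope.
    have h1 : Filter.Tendsto (fun n => φ (b n * unitFiber L S a - unitFiber L S a)) Filter.atTop
        (nhds 0) := by
      have := (hb.mul_const (φ (unitFiber L S a))).sub_const (φ (unitFiber L S a))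
      rw [(he _).1, sub_self] at this
      simpa only [map_sub, map_mul] using this
    rw [tendsto_iff_norm_sub_tendsto_zero]
    refine squeeze_zero (fun _ => norm_nonneg _) (fun n => ?_) (by simpa using h1.norm)
    have h2 := norm_fn_le_norm_toEnveloping (b n * unitFiber L S a - unitFiber L S a) 1
    rw [fn_sub, Pi.sub_apply, mul_unitFiber, S.α_one] at h2
    classical
    rw [fn_unitFiber, Pi.single_eq_same] at h2
    rwa [← map_mul, ← map_sub]
  -- The element u δ_1 is a left unit on a dense subset of the envelope, so it equals e.
  have hφ : ∀ c, φ (unitFiber L S u) * c = c := fun c => by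
    refine denseRange_toEnveloping.induction_on
      (p := fun c => φ (unitFiber L S u) * c = c) c
      (isClosed_eq (continuous_const.mul continuous_id) continuous_id) fun x => ?_
    have e1 : unitFiber L S u * x = x := ext (funext fun y => by rw [unitFiber_mul, hua])
    change φ _ * φ x = φ x
    rw [← map_mul, e1]
  exact ⟨unitFiber L S u, by rw [← hφ e]; exact (he _).2.symm⟩

theorem isInverseClosed_range_toEnveloping
    (hB : IsSymmetricBanachStarAlgebra (TwistedCrossedProduct L S)) :
    IsInverseClosed (NonUnitalStarAlgHom.range (toEnveloping (TwistedCrossedProduct L S))) where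
  quasiInverse_mem f hf g h1 h2 := hB.quasiInverse_mem_range hf h1 h2
  inverse_mem f hf g h1 h2 := by
    have he := unit_mem_range_toEnveloping h1
    have hgf : g * f = f * g := by rw [← (h1 (g * f)).1, (h2 (f * g)).2]
    -- Here fg is the unit, and g - 1 is the quasi-inverse of f - 1.
    have hg : g - f * g ∈ NonUnitalStarAlgHom.range (toEnveloping (TwistedCrossedProduct L S)) := by
      refine hB.quasiInverse_mem_range (f := f - f * g) (sub_mem hf he) ?_ ?_
      · rw [sub_mul, mul_sub, mul_sub, (h1 g).1, (h1 f).2, (h1 (f * g)).1]; abel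
      · rw [sub_mul, mul_sub, mul_sub, (h1 g).2, (h1 f).1, (h1 (f * g)).1, hgf]; abel
    simpa using add_mem hg he

end TwistedCrossedProduct

/-! ### Untwisting: the embedding in an untwisted algebra with coefficients in A ⋊ G -/

namespace TwistedCrossedProduct

variable {G A : Type*} [Group G] [NonUnitalCStarAlgebra A]

open Classical in
/-- The function with value `a` at `x` and `0` elsewhere, in the `ℓ¹`-crossed product. -/
noncomputable def single (S : TwistedSystem G A) (x : G) (a : A) :
    TwistedCrossedProduct (AdmissibleAlgebra.l1 G) S :=
  mk (Pi.single x a) (show absFun (Pi.single x a : G → A) ∈ (AdmissibleAlgebra.l1 G).carrier from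
    summable_of_ne_finset_zero (s := {x}) fun y hy => by
      rw [norm_absFun, Pi.single_eq_of_ne (by simpa using hy), norm_zero])

variable (S : TwistedSystem G A)

theorem fn_single [DecidableEq G] (x : G) (a : A) : (single S x a).fn = Pi.single x a := by
  rw [single, fn_mk]
  congr!

theorem norm_single (x : G) (a : A) : ‖single S x a‖ = ‖a‖ := by
  classical
  rw [norm_def]
  change ∑' y, ‖absFun (single S x a).fn y‖ = _
  rw [fn_single, tsum_eq_single x]
  · rw [norm_absFun, Pi.single_eq_same]
  · intro y hy
    rw [norm_absFun, Pi.single_eq_of_ne hy, norm_zero]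

theorem single_mul_single (x y : G) (a b : A) :
    single S x a * single S y b = single S (x * y) (S.term x y a b) := by
  classical
  refine ext (funext fun z => ?_)
  rw [fn_mul, fn_single, fn_single, fn_single, TwistedSystem.convolution, tsum_eq_single x]
  · rw [Pi.single_eq_same]
    rcases eq_or_ne z (x * y) with rfl | hz
    · rw [inv_mul_cancel_left, Pi.single_eq_same, Pi.single_eq_same]
    · rw [Pi.single_eq_of_ne hz, Pi.single_eq_of_ne, S.term_zero_right]
      rintro rfl
      exact hz (mul_inv_cancel_left x z).symm
  · intro w hw
    rw [Pi.single_eq_of_ne hw, S.term_zero_left]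

theorem star_single_inv (f : G → A) (x : G) :
    star (single S x⁻¹ (f x⁻¹)) = single S x (S.involution f x) := by
  classical
  refine ext (funext fun z => ?_)
  rw [fn_star, fn_single, fn_single, TwistedSystem.involution]
  rcases eq_or_ne z x with rfl | hz
  · rw [Pi.single_eq_same, Pi.single_eq_same]; rfl
  · rw [Pi.single_eq_of_ne hz, Pi.single_eq_of_ne (by simpa using hz)]
    simp

/-- The fibre of the crossed product `C⋆`-algebra at `x`. -/
noncomputable def fiber (x : G) : A →L[ℂ] TwistedCrossedProductCStar S :=
  LinearMap.mkContinuous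
    { toFun := fun a => toEnveloping _ (single S x a)
      map_add' := fun a b => by
        classical
        rw [← map_add]
        congr 1
        exact ext (by rw [fn_add, fn_single, fn_single, fn_single, Pi.single_add])
      map_smul' := fun c a => by
        classical
        rw [RingHom.id_apply, ← map_smul]
        congr 1
        exact ext (by rw [fn_smul, fn_single, fn_single, Pi.single_smul]) } 1
    fun a => by
      rw [one_mul, ← norm_single S x a]
      exact norm_toEnveloping_le _

theorem fiber_apply (x : G) (a : A) : fiber S x a = toEnveloping _ (single S x a) := rfl

/-- The enveloping norm is at most the `ℓ¹`-norm, which is ‖a‖ here, and at least the norm of the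
value at x. This equality is what makes the untwisting isometric for every L. -/
theorem norm_fiber (x : G) (a : A) : ‖fiber S x a‖ = ‖a‖ := by
  classical
  refine le_antisymm ((norm_toEnveloping_le _).trans_eq (norm_single S x a)) ?_
  have h := norm_fn_le_norm_toEnveloping (single S x a) x
  rwa [fn_single, Pi.single_eq_same] at h

/-- Multiplication in A ⋊ G already contains α and ω, so a convolution with these coefficients needs
no further twist. -/
theorem fiber_mul_fiber (x y : G) (a b : A) :
    fiber S x a * fiber S y b = fiber S (x * y) (S.term x y a b) := by
  rw [fiber_apply, fiber_apply, fiber_apply, ← map_mul, single_mul_single]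

theorem star_fiber_inv (f : G → A) (x : G) :
    star (fiber S x⁻¹ (f x⁻¹)) = fiber S x (S.involution f x) := by
  rw [fiber_apply, fiber_apply, ← map_star, star_single_inv]

variable (L : AdmissibleAlgebra G)

theorem absFun_fiber (f : G → A) : absFun (fun x => fiber S x (f x)) = absFun f := by
  funext x
  rw [absFun, absFun, norm_fiber]

/-- The embedding of the twisted crossed product in an untwisted one, which maps `f` to
`x ↦ f(x) δ_x`. -/
noncomputable def untwist : TwistedCrossedProduct L S →⋆ₙₐ[ℂ]
    TwistedCrossedProduct L (TwistedSystem.trivial G (TwistedCrossedProductCStar S)) where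
  toFun f := mk (fun x => fiber S x (f.fn x)) (by rw [absFun_fiber]; exact f.absFun_mem)
  map_smul' c f := ext (funext fun x => by
    rw [fn_mk, fn_smul, Pi.smul_apply, map_smul]; rfl)
  map_zero' := ext (funext fun x => by
    rw [fn_mk, fn_zero, Pi.zero_apply, map_zero]; rfl)
  map_add' f g := ext (funext fun x => by
    rw [fn_mk, fn_add, Pi.add_apply, map_add]; rfl)
  map_mul' f g := ext (funext fun x => by
    rw [fn_mk, fn_mul, fn_mul, fn_mk, fn_mk, TwistedSystem.convolution, TwistedSystem.convolution,
      (fiber S x).map_tsum (S.summable_term f.summable g.summable x)]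
    refine tsum_congr fun y => ?_
    rw [TwistedSystem.trivial_term, fiber_mul_fiber, mul_inv_cancel_left])
  map_star' f := ext (funext fun x => by
    rw [fn_mk, fn_star, fn_star, fn_mk, TwistedSystem.trivial_involution, star_fiber_inv])

theorem norm_untwist (f : TwistedCrossedProduct L S) : ‖untwist S L f‖ = ‖f‖ := by
  rw [norm_def, norm_def]
  exact congrArg L.nrm (absFun_fiber S f.fn)

end TwistedCrossedProduct

/-! ### The main theorem -/

theorem IsRigidlySymmetric.isTCPRigidlySymmetric {G : Type u} [Group G] {L : AdmissibleAlgebra G}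
    (hL : IsRigidlySymmetric.{u, v} L) : IsTCPRigidlySymmetric.{u, v} L := fun _ _ S =>
  -- Rigid symmetry is applied to the coefficient algebra A ⋊ G, formed from `ℓ¹` whatever L is; it
  -- lies in the same universe `max u v` as A.
  IsSymmetricBanachStarAlgebra.of_isometry (hL (TwistedCrossedProductCStar S))
    (TwistedCrossedProduct.untwist S L) (TwistedCrossedProduct.norm_untwist S L)

theorem mainTheorem1 {G : Type u} [Group G] :
    (∀ L : AdmissibleAlgebra G, IsRigidlySymmetric.{u, v} L →
      ∀ (A : Type (max u v)) [NonUnitalCStarAlgebra A] (S : TwistedSystem G A),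
        IsSymmetricBanachStarAlgebra (TwistedCrossedProduct L S) ∧
        Function.Injective (toEnveloping (TwistedCrossedProduct L S)) ∧
        IsInverseClosed (NonUnitalStarAlgHom.range (toEnveloping (TwistedCrossedProduct L S))) ∧
        ∀ (H : Type w) [NormedAddCommGroup H] [InnerProductSpace ℂ H] [CompleteSpace H]
          (Φ : EnvelopingCStarAlgebra (TwistedCrossedProduct L S) →⋆ₙₐ[ℂ] (H →L[ℂ] H)),
          Function.Injective Φ →
          IsInverseClosed (NonUnitalStarAlgHom.range
            (Φ.comp (toEnveloping (TwistedCrossedProduct L S))))) ∧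
    (IsRigidlySymmetric.{u, v} (AdmissibleAlgebra.l1 G) →
      ∀ (A : Type (max u v)) [NonUnitalCStarAlgebra A] (S : TwistedSystem G A),
        IsInverseClosed (NonUnitalStarAlgHom.range
          (toEnveloping (TwistedCrossedProduct (AdmissibleAlgebra.l1 G) S))) ∧
        ∀ (H : Type w) [NormedAddCommGroup H] [InnerProductSpace ℂ H] [CompleteSpace H]
          (Φ : TwistedCrossedProductCStar S →⋆ₙₐ[ℂ] (H →L[ℂ] H)),
          Function.Injective Φ →
          IsInverseClosed (NonUnitalStarAlgHom.range
            (Φ.comp (toEnveloping (TwistedCrossedProduct (AdmissibleAlgebra.l1 G) S))))) ∧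
    (∀ L : AdmissibleAlgebra G,
      IsTCPRigidlySymmetric.{u, v} L ↔ IsRigidlySymmetric.{u, v} L) := by
  have key : ∀ L : AdmissibleAlgebra G, IsRigidlySymmetric.{u, v} L →
      ∀ (A : Type (max u v)) [NonUnitalCStarAlgebra A] (S : TwistedSystem G A),
        IsInverseClosed (NonUnitalStarAlgHom.range (toEnveloping (TwistedCrossedProduct L S))) ∧
        ∀ (H : Type w) [NormedAddCommGroup H] [InnerProductSpace ℂ H] [CompleteSpace H]
          (Φ : EnvelopingCStarAlgebra (TwistedCrossedProduct L S) →⋆ₙₐ[ℂ] (H →L[ℂ] H)),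
          Function.Injective Φ →
          IsInverseClosed (NonUnitalStarAlgHom.range
            (Φ.comp (toEnveloping (TwistedCrossedProduct L S)))) := fun L hL _ _ S =>
    have h := TwistedCrossedProduct.isInverseClosed_range_toEnveloping
      (hL.isTCPRigidlySymmetric _ S)
    ⟨h, fun _ _ _ _ Φ hΦ => IsInverseClosed.comp Φ _ h hΦ⟩
  exact ⟨fun L hL A _ S => ⟨hL.isTCPRigidlySymmetric A S,
      TwistedCrossedProduct.toEnveloping_injective, key L hL A S⟩,
    key (AdmissibleAlgebra.l1 G),
    -- One direction specializes to the trivial system, the other is the untwisting.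
    fun L => ⟨fun h _ _ => h _ _, IsRigidlySymmetric.isTCPRigidlySymmetric⟩⟩
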